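/- Let $N\ge 1$, $l\ge 1$, $m=2l$, $D_j=-i\,\partial/\partial x_j$, and let $A(D)=\sum_{|\alpha|=m}a_\alpha D^\alpha$ be a homogeneous differential operator with constant real coefficients that is elliptic in the sense that $A(\xi)=\sum_{|\alpha|=m}a_\alpha\xi^\alpha>0$ for all $\xi\in\mathbb{R}^N\setminus\{0\}$. Let $0<\rho<1$, $T>0$, $\tau>N/2$. For $f\in L_2(\mathbb{R}^N)$ let $\hat f$ be its ($L_2$-) Fourier transform, normalized by $\hat f(\xi)=(2\pi)^{-N}\int_{\mathbb{R}^N} f(x)e^{-ix\xi}\,dx$, and let $L_2^\tau(\mathbb{R}^N)$ be the set of (complex-valued) $f\in L_2(\mathbb{R}^N)$ with $\int_{\mathbb{R}^N}(1+|\xi|^2)^\tau|\hat f(\xi)|^2\,d\xi<\infty$. Let $E_\rho(z)=\sum_{k\ge0}z^k/\Gamma(\rho k+1)$, and let $D_t^\rho h(t)=\frac1{\Gamma(1-\rho)}\int_0^t (t-s)^{-\rho}h'(s)\,ds$ be the Caputo derivative. Let $\varphi\in L_2^\tau(\mathbb{R}^N)$. Then $\varphi$ has a continuous representative, again denoted by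 $\varphi$, and the function $$u(x,t)=\int_{\mathbb{R}^N}E_\rho(-A(\xi)t^\rho)\,\hat\varphi(\xi)\,e^{ix\xi}\,d\xi,\qquad x\in\mathbb{R}^N,\ 0\le t\le T,$$ whose integrand is absolutely integrable, is a classical solution of the forward problem $$D_t^\rho u(x,t)+A(D)u(x,t)=0,\qquad x\in\mathbb{R}^N,\ 0<t\le T,$$ $$\lim_{|x|\to\infty}D^\alpha u(x,t)=0,\qquad |\alpha|\le l-1,\ 0<t\le T,$$ $$u(x,0)=\varphi(x),\qquad x\in\mathbb{R}^N.$$ Here classical solution means that $u$ is continuous on $\mathbb{R}^N\times[0,T]$, that $u(\cdot,t)$ is $m$ times continuously differentiable for every $t\in(0,T]$, that for every $x$ the function $u(x,\cdot)$ is differentiable on $(0,T)$ and the integral defining $D_t^\rho u(x,t)$ converges absolutely for every $t\in(0,T]$, that $D_t^\rho u$ and $A(D)u$ are continuous on $\mathbb{R}^N\times(0,T]$, and that the three relations above hold. For each $t\in(0,T]$ the integral converges uniformly in $x\in\mathbb{R}^N$: the integrals over $\{A(\xi)<\mu\}$, and likewise those over $\{|\xi|<\mu\}$, converge to $u(x,t)$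 as $\mu\to\infty$, uniformly in $x$. Moreover, $u$ satisfies the following four conditions for all $t\in(0,T]$: (1) $\varphi\in C(\mathbb{R}^N)$; (2) $\lim_{|x|\to\infty}D^\alpha u(x,t)=0$ for $l\le|\alpha|\le m-1$; (3) $D^\alpha u(\cdot,t)\in L_2(\mathbb{R}^N)$ for $|\alpha|\le m$; (4) $\hat u(\cdot,t)\in L_1(\mathbb{R}^N)$. -/

import Mathlib

open MeasureTheory Filter Topology Set

noncomputable section

namespace Subdiffusion

/-! ### Differential operators with constant coefficients -/

/-- `D_j = -i ∂/∂x_j`, acting on complex valued functions on `ℝ^N`. -/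
def partialD {N : ℕ} (j : Fin N) (f : EuclideanSpace ℝ (Fin N) → ℂ) :
    EuclideanSpace ℝ (Fin N) → ℂ :=
  fun x => -Complex.I * lineDeriv ℝ f x (EuclideanSpace.single j 1)

/-- `D^α = D_1^{α_1} ⋯ D_N^{α_N}`. -/
def multiD {N : ℕ} (α : Fin N →₀ ℕ) (f : EuclideanSpace ℝ (Fin N) → ℂ) :
    EuclideanSpace ℝ (Fin N) → ℂ :=
  (List.finRange N).foldr (fun j g => (partialD j)^[α j] g) f

/-- The symbol `A(ξ) = ∑_α a_α ξ^α`. -/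
def symbol {N : ℕ} (A : MvPolynomial (Fin N) ℝ) (ξ : EuclideanSpace ℝ (Fin N)) : ℝ :=
  MvPolynomial.eval (fun j => ξ j) A

/-- The operator `A(D) = ∑_α a_α D^α`. -/
def diffOp {N : ℕ} (A : MvPolynomial (Fin N) ℝ) (f : EuclideanSpace ℝ (Fin N) → ℂ) :
    EuclideanSpace ℝ (Fin N) → ℂ :=
  fun x => ∑ α ∈ A.support, ((A.coeff α : ℝ) : ℂ) * multiD α f x

/-- `A(D)` is homogeneous and elliptic of order `2 l`. The coefficients being real, `A(D)` is
formally self-adjoint. -/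
structure IsHomogeneousElliptic {N : ℕ} (A : MvPolynomial (Fin N) ℝ) (l : ℕ) : Prop where
  homogeneous : A.IsHomogeneous (2 * l)
  elliptic : ∀ ξ : EuclideanSpace ℝ (Fin N), ξ ≠ 0 → 0 < symbol A ξ

/-! ### Fractional integrals and derivatives -/

/-- The Riemann-Liouville integral `∂_t^r h (t)` of order `r < 0`. -/
def rlIntegral (r : ℝ) (h : ℝ → ℂ) (t : ℝ) : ℂ :=
  (Real.Gamma (-r))⁻¹ • ∫ s in (0 : ℝ)..t, ((t - s) ^ (r + 1))⁻¹ • h s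

/-- The Caputo derivative `D_t^ρ h (t) = ∂_t^{ρ-1} (dh/dt) (t)` of order `0 < ρ < 1`. -/
def caputoDeriv (ρ : ℝ) (h : ℝ → ℂ) (t : ℝ) : ℂ :=
  rlIntegral (ρ - 1) (deriv h) t

/-- The Caputo derivative of order `ρ` of `h` exists at the time `t`: `h` is differentiable on
`(0, t)` and the integral that defines the Caputo derivative converges absolutely. -/
def CaputoExists (ρ : ℝ) (h : ℝ → ℂ) (t : ℝ) : Prop :=
  (∀ s ∈ Ioo 0 t, DifferentiableAt ℝ h s) ∧
    IntegrableOn (fun s => ((t - s) ^ ρ)⁻¹ • deriv h s) (Ioo 0 t)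

/-- The Mittag-Leffler function `E_ρ(z) = ∑ z^k / Γ(ρ k + 1)`. -/
def mittagLeffler (ρ z : ℝ) : ℝ :=
  ∑' k : ℕ, z ^ k / Real.Gamma (ρ * k + 1)

/-! ### The Fourier transform on `L_2` and Sobolev classes -/

open scoped Classical FourierTransform in
/-- The Fourier transform of `f ∈ L_2(ℝ^N)` (Plancherel), with the normalisation
`f̂(ξ) = (2π)^{-N} ∫ f(x) e^{-ixξ} dx`; Mathlib's transform is `∫ f(x) e^{-2πixη} dx`. -/
def fourierL2 {N : ℕ} (f : EuclideanSpace ℝ (Fin N) → ℂ) : EuclideanSpace ℝ (Fin N) → ℂ :=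
  if h : MemLp f 2 volume then
    fun ξ => (((2 * Real.pi) ^ N)⁻¹ : ℝ) •
      ((𝓕 (h.toLp f) : Lp ℂ 2 (volume : Measure (EuclideanSpace ℝ (Fin N)))) :
        EuclideanSpace ℝ (Fin N) → ℂ) ((2 * Real.pi)⁻¹ • ξ)
  else 0

/-- The Sobolev class `L_2^a(ℝ^N)`: those `f ∈ L_2` with `∫ (1+|ξ|²)^a |f̂(ξ)|² dξ < ∞`. -/
def MemSobolevClass {N : ℕ} (a : ℝ) (f : EuclideanSpace ℝ (Fin N) → ℂ) : Prop :=
  MemLp f 2 volume ∧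
    Integrable (fun ξ : EuclideanSpace ℝ (Fin N) => (1 + ‖ξ‖ ^ 2) ^ a * ‖fourierL2 f ξ‖ ^ 2)

/-! ### The forward problem -/

/-- `u` is a classical solution, on `ℝ^N × [0, T]`, of `D_t^ρ u + A(D) u = 0` for `0 < t ≤ T`,
`D^α u(x,t) → 0` as `|x| → ∞` for `|α| ≤ l - 1` and `0 < t ≤ T`, and `u(x,0) = φ(x)`. The
derivatives in the equation exist in the classical sense and are continuous on `ℝ^N × (0, T]`;
the initial value is attained continuously. -/
structure IsClassicalSolution {N : ℕ} (A : MvPolynomial (Fin N) ℝ) (l : ℕ) (ρ T : ℝ)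
    (φ : EuclideanSpace ℝ (Fin N) → ℂ) (u : EuclideanSpace ℝ (Fin N) → ℝ → ℂ) : Prop where
  continuousOn : ContinuousOn (fun p : EuclideanSpace ℝ (Fin N) × ℝ => u p.1 p.2)
    (univ ×ˢ Icc 0 T)
  contDiff : ∀ t ∈ Ioc 0 T, ContDiff ℝ ((2 * l : ℕ) : WithTop ℕ∞) (fun x => u x t)
  caputoExists : ∀ x, ∀ t ∈ Ioc 0 T, CaputoExists ρ (u x) t
  continuousOn_caputo : ContinuousOn
    (fun p : EuclideanSpace ℝ (Fin N) × ℝ => caputoDeriv ρ (u p.1) p.2) (univ ×ˢ Ioc 0 T)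
  continuousOn_diffOp : ContinuousOn
    (fun p : EuclideanSpace ℝ (Fin N) × ℝ => diffOp A (fun x => u x p.2) p.1) (univ ×ˢ Ioc 0 T)
  equation : ∀ x, ∀ t ∈ Ioc 0 T, caputoDeriv ρ (u x) t + diffOp A (fun y => u y t) x = 0
  decay : ∀ α : Fin N →₀ ℕ, α.degree < l → ∀ t ∈ Ioc 0 T,
    Tendsto (multiD α (fun x => u x t)) (cocompact (EuclideanSpace ℝ (Fin N))) (𝓝 0)
  initial : ∀ x, u x 0 = φ x

/-- The four conditions under which the solution of the forward problem is unique. -/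
structure UniquenessConditions {N : ℕ} (l : ℕ) (T : ℝ)
    (φ : EuclideanSpace ℝ (Fin N) → ℂ) (u : EuclideanSpace ℝ (Fin N) → ℝ → ℂ) : Prop where
  continuous_initial : Continuous φ
  decay : ∀ t ∈ Ioc 0 T, ∀ α : Fin N →₀ ℕ, l ≤ α.degree → α.degree < 2 * l →
    Tendsto (multiD α (fun x => u x t)) (cocompact (EuclideanSpace ℝ (Fin N))) (𝓝 0)
  memLp : ∀ t ∈ Ioc 0 T, ∀ α : Fin N →₀ ℕ, α.degree ≤ 2 * l →
    MemLp (multiD α (fun x => u x t)) 2 volume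
  integrable_fourier : ∀ t ∈ Ioc 0 T, Integrable (fourierL2 (fun x => u x t)) volume

/-- The integrand `E_ρ(-A(ξ) t^ρ) φ̂(ξ) e^{ixξ}`. -/
def solutionIntegrand {N : ℕ} (A : MvPolynomial (Fin N) ℝ) (ρ : ℝ)
    (φ : EuclideanSpace ℝ (Fin N) → ℂ) (x : EuclideanSpace ℝ (Fin N)) (t : ℝ)
    (ξ : EuclideanSpace ℝ (Fin N)) : ℂ :=
  (mittagLeffler ρ (-symbol A ξ * t ^ ρ) : ℂ) * fourierL2 φ ξ *
    Complex.exp (Complex.I * ((inner ℝ x ξ : ℝ) : ℂ))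

end Subdiffusion

end

/-! The Fourier transform decouples the problem. For `λ = A(ξ) ≥ 0` the function `E_ρ(-λ t^ρ)`
solves the scalar equation `D_t^ρ y = -λ y`, `y(0) = 1`, and `u` superposes these solutions with
weight `φ̂(ξ) e^{ixξ}`. What remains is to justify the passage of limits, derivatives and the Caputo
integral under the integral sign, and this needs bounds that are uniform in `λ`: (a) `0 ≤ E_ρ(-λ
t^ρ) ≤ 1` (`mittagLeffler_mem_Icc`); (b) `λ E_ρ(-λ t^ρ) ≤ C t^{-ρ}` (`mul_mittagLeffler_le`); (c)
`|d/dt E_ρ(-λ t^ρ)| ≤ C λ^ε t^{ρε-1}` for `0 < ε ≤ 1` (`mul_relaxation_le_rpow`).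

Since `τ > N/2`, Cauchy-Schwarz puts `φ̂` in `L_1`, so by (a) it dominates the integrand. This gives
continuity up to `t = 0` and uniform convergence, and inversion gives the continuous representative.
By ellipticity `|ξ|^{2l} ≤ C A(ξ)`, so (b) bounds all moments up to order `2l` for `t > 0`. Hence
the spatial derivatives may be taken under the integral; they are inverse Fourier integrals of
functions in `L_1 ∩ L_2`, so they vanish at infinity by Riemann-Lebesgue and lie in `L_2`. The
strict inequality `τ > N/2` also leaves room for a small `ε` with `A^ε φ̂ ∈ L_1`. As `s^{ρε-1}` is
integrable against `(t-s)^{-ρ}`, (c) permits Fubini in the Caputo integral.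

The bounds (a)-(c) are proved with real methods. With `k_b(t) = t^{b-1}/Γ(b)`, the function `r(t) =
t^{ρ-1} E_{ρ,ρ}(-λ t^ρ)` satisfies the Volterra equation `r + λ k_ρ * r = k_ρ`, and the derivative
of `E_ρ(-λ t^ρ)` is `-λ r`. The core is `relaxation_pos`: `r > 0`, because `k_ρ` is log-convex.
Positivity yields monotonicity and (a), monotonicity yields (b), and a second Volterra equation, for
`t r(t)` (`mul_relaxation_add`), yields (c). -/

namespace Subdiffusion

/-! ### Fractional power kernels -/

/-- The kernel `t^(b-1) / Γ(b)` of the fractional integral of order `b`. -/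
noncomputable def fracKernel (b t : ℝ) : ℝ := t ^ (b - 1) / Real.Gamma b

theorem fracKernel_pos {b t : ℝ} (hb : 0 < b) (ht : 0 < t) : 0 < fracKernel b t :=
  div_pos (Real.rpow_pos_of_pos ht _) (Real.Gamma_pos_of_pos hb)

theorem fracKernel_one (t : ℝ) : fracKernel 1 t = 1 := by simp [fracKernel]

/-- Euler's Beta integral, rescaled to `[0, t]`. This semigroup law is what allows Mittag-Leffler
series to be convolved term by term. -/
theorem intervalIntegral_fracKernel {a b t : ℝ} (ha : 0 < a) (hb : 0 < b) (ht : 0 < t) :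
    ∫ s in (0 : ℝ)..t, fracKernel a (t - s) * fracKernel b s = fracKernel (a + b) t := by
  have h := Complex.betaIntegral_scaled (b : ℂ) (a : ℂ) ht
  rw [Complex.betaIntegral_eq_Gamma_mul_div _ _ (by simpa using hb) (by simpa using ha)] at h
  have h1 : ∫ x in (0 : ℝ)..t, x ^ (b - 1) * (t - x) ^ (a - 1)
      = t ^ (b + a - 1) * (Real.Gamma b * Real.Gamma a / Real.Gamma (b + a)) := by
    have h2 : ((∫ x in (0 : ℝ)..t, x ^ (b - 1) * (t - x) ^ (a - 1) : ℝ) : ℂ)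
        = ((t ^ (b + a - 1) * (Real.Gamma b * Real.Gamma a / Real.Gamma (b + a)) : ℝ) : ℂ) := by
      rw [← intervalIntegral.integral_ofReal]
      push_cast [Complex.ofReal_cpow ht.le, ← Complex.Gamma_ofReal]
      rw [← h]
      refine intervalIntegral.integral_congr fun x hx => ?_
      rw [uIcc_of_le ht.le] at hx
      rw [Complex.ofReal_cpow hx.1, Complex.ofReal_cpow (sub_nonneg.2 hx.2)]
      push_cast
      rfl
    exact_mod_cast h2
  have hA := (Real.Gamma_pos_of_pos ha).ne'
  have hB := (Real.Gamma_pos_of_pos hb).ne'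
  have h3 : ∀ s, fracKernel a (t - s) * fracKernel b s
      = (Real.Gamma a * Real.Gamma b)⁻¹ * (s ^ (b - 1) * (t - s) ^ (a - 1)) := by
    intro s
    simp only [fracKernel]
    field_simp
  simp_rw [h3]
  rw [intervalIntegral.integral_const_mul, h1, fracKernel, add_comm b a]
  field_simp

theorem setIntegral_fracKernel {a b t : ℝ} (ha : 0 < a) (hb : 0 < b) (ht : 0 < t) :
    ∫ s in Ioo 0 t, fracKernel a (t - s) * fracKernel b s = fracKernel (a + b) t := by
  rw [← integral_Ioc_eq_integral_Ioo, ← intervalIntegral.integral_of_le ht.le,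
    intervalIntegral_fracKernel ha hb ht]

theorem integrableOn_fracKernel {a b t : ℝ} (ha : 0 < a) (hb : 0 < b) (ht : 0 < t) :
    IntegrableOn (fun s => fracKernel a (t - s) * fracKernel b s) (Ioo 0 t) := by
  -- A non-integrable function would have integral `0`, but the Beta integral gives a positive
  -- value.
  by_contra h
  have := setIntegral_fracKernel ha hb ht
  rw [integral_undef h] at this
  exact (fracKernel_pos (add_pos ha hb) ht).ne this

/-- In the Gamma integral only the range `s > M` is kept, where `s^x ≥ M^x`. As `M` is free, this
shows that `Γ` outgrows every exponential. -/
theorem rpow_mul_exp_le_Gamma {x M : ℝ} (hx : 0 ≤ x) (hM : 0 < M) :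
    M ^ x * Real.exp (-M) ≤ Real.Gamma (x + 1) := by
  rw [Real.Gamma_eq_integral (by linarith), ← integral_exp_neg_Ioi, ← integral_const_mul]
  have hi := Real.GammaIntegral_convergent (s := x + 1) (by linarith)
  calc ∫ s in Ioi M, M ^ x * Real.exp (-s)
      ≤ ∫ s in Ioi M, Real.exp (-s) * s ^ (x + 1 - 1) := by
        refine setIntegral_mono_on ((integrableOn_exp_neg_Ioi M).const_mul _)
          (hi.mono_set (Ioi_subset_Ioi hM.le)) measurableSet_Ioi fun s hs => ?_
        rw [mul_comm, add_sub_cancel_right]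
        have : M ^ x ≤ s ^ x := Real.rpow_le_rpow hM.le (le_of_lt hs) hx
        gcongr
    _ ≤ _ := setIntegral_mono_set hi (ae_restrict_of_forall_mem measurableSet_Ioi fun s hs =>
        mul_nonneg (Real.exp_pos _).le (Real.rpow_nonneg (le_of_lt hs) _))
        (Ioi_subset_Ioi hM.le).eventuallyLE

theorem summable_mul_pow_div_Gamma {ρ β : ℝ} (hρ : 0 < ρ) (hβ : 0 < β) {R : ℝ} (hR : 0 ≤ R) :
    Summable fun n : ℕ => (n + 1 : ℝ) * R ^ n / Real.Gamma (ρ * n + β) := by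
  -- With `M ^ ρ = 2 (R + 1)`, the lower bound for `Γ` grows like `(2 (R + 1))^n`, which beats `R^n`
  -- by the geometric factor `2^{-n}`.
  set M : ℝ := (2 * (R + 1)) ^ ρ⁻¹ with hMdef
  have hM : 0 < M := Real.rpow_pos_of_pos (by linarith) _
  have hMρ : M ^ ρ = 2 * (R + 1) := Real.rpow_inv_rpow (by linarith) hρ.ne'
  have hs : Summable fun n : ℕ => (ρ + β) * Real.exp M * M ^ (-β) * 2 *
      (((n + 1 : ℕ) : ℝ) ^ 2 * (1 / 2 : ℝ) ^ (n + 1)) :=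
    ((summable_nat_add_iff 1).2
      (summable_pow_mul_geometric_of_norm_lt_one 2 (r := (1 / 2 : ℝ)) (by norm_num))).mul_left _
  refine hs.of_nonneg_of_le (fun n => ?_) fun n => ?_
  · have := Real.Gamma_pos_of_pos (s := ρ * n + β) (by positivity)
    positivity
  · set x := ρ * n + β with hx
    have hx0 : 0 < x := by positivity
    have hG := Real.Gamma_pos_of_pos hx0
    have h1 := rpow_mul_exp_le_Gamma hx0.le hM
    rw [Real.Gamma_add_one hx0.ne'] at h1
    have hMx : M ^ x = (2 * (R + 1)) ^ n * M ^ β := by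
      rw [hx, Real.rpow_add hM, Real.rpow_mul hM.le, hMρ, Real.rpow_natCast]
    have hxle : x ≤ (ρ + β) * (n + 1) := by
      have hn : (0 : ℝ) ≤ n := n.cast_nonneg
      nlinarith
    have h2 : (Real.Gamma x)⁻¹ ≤ x * (Real.exp M * M ^ (-β) * ((2 * (R + 1)) ^ n)⁻¹) := by
      rw [inv_le_iff_one_le_mul₀ hG]
      have : 0 < M ^ x * Real.exp (-M) := by positivity
      have e : Real.exp M * M ^ (-β) * ((2 * (R + 1)) ^ n)⁻¹ = (M ^ x * Real.exp (-M))⁻¹ := by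
        rw [hMx, Real.exp_neg, Real.rpow_neg hM.le]
        field_simp
      rw [e, mul_right_comm, ← div_eq_mul_inv, one_le_div this]
      exact h1
    have h3 : R ^ n * ((2 * (R + 1)) ^ n)⁻¹ ≤ (1 / 2) ^ n := by
      rw [← div_eq_mul_inv, ← div_pow]
      refine pow_le_pow_left₀ (by positivity) ?_ n
      rw [div_le_div_iff₀ (by positivity) (by norm_num)]
      linarith
    calc (n + 1 : ℝ) * R ^ n / Real.Gamma x
        ≤ (n + 1 : ℝ) * R ^ n * (((ρ + β) * (n + 1)) *
            (Real.exp M * M ^ (-β) * ((2 * (R + 1)) ^ n)⁻¹)) := by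
          rw [div_eq_mul_inv]
          gcongr
          exact h2.trans (by gcongr)
      _ = (ρ + β) * Real.exp M * M ^ (-β) * (n + 1) ^ 2 * (R ^ n * ((2 * (R + 1)) ^ n)⁻¹) := by ring
      _ ≤ (ρ + β) * Real.exp M * M ^ (-β) * (n + 1) ^ 2 * (1 / 2) ^ n := by gcongr
      _ = _ := by push_cast; ring

/-! ### Series of fractional kernels -/

/-- The series `∑ c_n t^(ρn+β-1) / Γ(ρn+β)`. -/
noncomputable def fracSeries (ρ : ℝ) (c : ℕ → ℝ) (β t : ℝ) : ℝ :=
  ∑' n : ℕ, c n * fracKernel (ρ * n + β) t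

/-- The coefficients `c` grow at most like `(n+1) Λ^n`. -/
def GeomBound (c : ℕ → ℝ) (Λ : ℝ) : Prop := 0 ≤ Λ ∧ ∀ n, |c n| ≤ (n + 1) * Λ ^ n

theorem fracKernel_eq {ρ β t : ℝ} (ht : 0 < t) (n : ℕ) :
    fracKernel (ρ * n + β) t = t ^ (β - 1) * ((t ^ ρ) ^ n / Real.Gamma (ρ * n + β)) := by
  rw [fracKernel, add_sub_assoc, Real.rpow_add ht, Real.rpow_mul ht.le, Real.rpow_natCast]
  ring

theorem GeomBound.abs_term_le {c : ℕ → ℝ} {Λ : ℝ} (hc : GeomBound c Λ) {ρ β x R : ℝ} (hρ : 0 < ρ)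
    (hβ : 0 < β) (hx : |x| ≤ R) (n : ℕ) :
    |c n * (x ^ n / Real.Gamma (ρ * n + β))|
      ≤ (n + 1) * (Λ * R) ^ n / Real.Gamma (ρ * n + β) := by
  have hG := Real.Gamma_pos_of_pos (s := ρ * n + β) (by positivity)
  have hΛ := hc.1
  rw [abs_mul, abs_div, abs_of_pos hG, abs_pow, mul_pow, mul_div_assoc, mul_div_assoc, ← mul_assoc]
  gcongr
  exact hc.2 n

theorem GeomBound.summable {c : ℕ → ℝ} {Λ : ℝ} (hc : GeomBound c Λ) {ρ β : ℝ} (hρ : 0 < ρ)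
    (hβ : 0 < β) (x : ℝ) : Summable fun n : ℕ => c n * (x ^ n / Real.Gamma (ρ * n + β)) :=
  Summable.of_norm_bounded
    (summable_mul_pow_div_Gamma hρ hβ (mul_nonneg hc.1 (abs_nonneg x)))
    fun n => hc.abs_term_le hρ hβ le_rfl n

theorem GeomBound.continuous {c : ℕ → ℝ} {Λ : ℝ} (hc : GeomBound c Λ) {ρ β : ℝ} (hρ : 0 < ρ)
    (hβ : 0 < β) : Continuous fun x : ℝ => ∑' n : ℕ, c n * (x ^ n / Real.Gamma (ρ * n + β)) := by
  refine continuous_iff_continuousAt.2 fun x₀ => ?_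
  have hco : ContinuousOn (fun x : ℝ => ∑' n : ℕ, c n * (x ^ n / Real.Gamma (ρ * n + β)))
      {x | |x| ≤ |x₀| + 1} :=
    continuousOn_tsum (fun n => by fun_prop)
      (summable_mul_pow_div_Gamma hρ hβ (R := Λ * (|x₀| + 1))
        (mul_nonneg hc.1 (by positivity)))
      fun n x hx => hc.abs_term_le hρ hβ hx n
  refine hco.continuousAt ?_
  filter_upwards [(continuous_abs.tendsto x₀).eventually (gt_mem_nhds (lt_add_one |x₀|))] with x hx
  exact le_of_lt hx

theorem fracSeries_eq {ρ : ℝ} (c : ℕ → ℝ) (β : ℝ) {t : ℝ} (ht : 0 < t) :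
    fracSeries ρ c β t
      = t ^ (β - 1) * ∑' n : ℕ, c n * ((t ^ ρ) ^ n / Real.Gamma (ρ * n + β)) := by
  rw [fracSeries, ← tsum_mul_left]
  refine tsum_congr fun n => ?_
  rw [fracKernel_eq ht]
  ring

theorem GeomBound.summable_fracKernel {c : ℕ → ℝ} {Λ : ℝ} (hc : GeomBound c Λ) {ρ β t : ℝ}
    (hρ : 0 < ρ) (hβ : 0 < β) (ht : 0 < t) :
    Summable fun n : ℕ => c n * fracKernel (ρ * n + β) t := by
  refine ((hc.summable hρ hβ (t ^ ρ)).mul_left (t ^ (β - 1))).congr fun n => ?_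
  rw [fracKernel_eq ht]
  ring

theorem GeomBound.continuousOn_fracSeries {c : ℕ → ℝ} {Λ : ℝ} (hc : GeomBound c Λ) {ρ β : ℝ}
    (hρ : 0 < ρ) (hβ : 0 < β) : ContinuousOn (fracSeries ρ c β) (Ioi 0) := by
  refine ContinuousOn.congr (f := fun t => t ^ (β - 1) *
    ∑' n : ℕ, c n * ((t ^ ρ) ^ n / Real.Gamma (ρ * n + β))) ?_ fun t ht => fracSeries_eq c β ht
  refine ContinuousOn.mul ?_ ?_
  · exact fun t ht => (Real.continuousAt_rpow_const t _ (Or.inl (ne_of_gt ht))).continuousWithinAt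
  · exact ((hc.continuous hρ hβ).comp (Real.continuous_rpow_const hρ.le)).continuousOn

theorem GeomBound.abs {c : ℕ → ℝ} {Λ : ℝ} (hc : GeomBound c Λ) : GeomBound (fun n => |c n|) Λ :=
  ⟨hc.1, fun n => by simpa using hc.2 n⟩

/-- Termwise convolution. The kernels are positive, so the `L_1` norms of the terms sum to the same
kind of series with `|c n|` in place of `c n`, and this converges. -/
theorem GeomBound.setIntegral_conv {c : ℕ → ℝ} {Λ : ℝ} (hc : GeomBound c Λ) {ρ β a t : ℝ}
    (hρ : 0 < ρ) (hβ : 0 < β) (ha : 0 < a) (ht : 0 < t) :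
    ∫ s in Ioo 0 t, fracKernel a (t - s) * fracSeries ρ c β s = fracSeries ρ c (β + a) t := by
  have hpos : ∀ n : ℕ, 0 < ρ * n + β := fun n => by positivity
  have hval : ∀ n : ℕ, ∫ s in Ioo 0 t, fracKernel a (t - s) * fracKernel (ρ * n + β) s
      = fracKernel (ρ * n + (β + a)) t := fun n => by
    rw [setIntegral_fracKernel ha (hpos n) ht]
    congr 1
    ring
  have hnorm : ∀ n : ℕ, ∫ s in Ioo 0 t, ‖c n * (fracKernel a (t - s) * fracKernel (ρ * n + β) s)‖
      = |c n| * fracKernel (ρ * n + (β + a)) t := fun n => by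
    rw [← hval n, ← integral_const_mul]
    refine setIntegral_congr_fun measurableSet_Ioo fun s hs => ?_
    rw [Real.norm_eq_abs, abs_mul, abs_of_pos (mul_pos (fracKernel_pos ha (sub_pos.2 hs.2))
      (fracKernel_pos (hpos n) hs.1))]
  have h := hasSum_integral_of_summable_integral_norm (μ := volume.restrict (Ioo 0 t))
    (F := fun (n : ℕ) s => c n * (fracKernel a (t - s) * fracKernel (ρ * n + β) s))
    (fun n => (integrableOn_fracKernel ha (hpos n) ht).const_mul _)
    (by simpa only [hnorm] using hc.abs.summable_fracKernel hρ (by linarith) ht)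
  rw [fracSeries]
  simp_rw [integral_const_mul, hval] at h
  rw [h.tsum_eq]
  refine integral_congr_ae (Eventually.of_forall fun s => ?_)
  simp only
  rw [fracSeries, ← tsum_mul_left]
  exact tsum_congr fun n => by ring

theorem measurable_fracKernel (b : ℝ) : Measurable (fracKernel b) := by
  unfold fracKernel
  fun_prop

theorem GeomBound.integrableOn_conv {c : ℕ → ℝ} {Λ : ℝ} (hc : GeomBound c Λ) {ρ β a t : ℝ}
    (hρ : 0 < ρ) (hβ : 0 < β) (ha : 0 < a) (ht : 0 < t) :
    IntegrableOn (fun s => fracKernel a (t - s) * fracSeries ρ c β s) (Ioo 0 t) := by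
  obtain ⟨C, hC⟩ := (isCompact_Icc (a := (0 : ℝ)) (b := t)).exists_bound_of_continuousOn
    (f := fun s : ℝ => ∑' n : ℕ, c n * ((s ^ ρ) ^ n / Real.Gamma (ρ * n + β)))
    ((hc.continuous hρ hβ).comp (Real.continuous_rpow_const hρ.le)).continuousOn
  have hΓ := Real.Gamma_pos_of_pos hβ
  -- The series is `s^{β-1}` times a function continuous on `[0, t]`, bounded there by `C`; the
  -- factor `Γ(β)` undoes the normalisation of the kernel.
  refine ((integrableOn_fracKernel ha hβ ht).const_mul (C * Real.Gamma β)).mono' ?_ ?_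
  · refine AEStronglyMeasurable.mul ?_ ?_
    · exact ((measurable_fracKernel a).comp (measurable_const.sub measurable_id)).aestronglyMeasurable
    · exact ((hc.continuousOn_fracSeries hρ hβ).mono fun s hs => hs.1).aestronglyMeasurable
        measurableSet_Ioo
  · refine ae_restrict_of_forall_mem measurableSet_Ioo fun s hs => ?_
    have h1 := fracKernel_pos ha (sub_pos.2 hs.2)
    have h2 : 0 < s ^ (β - 1) := Real.rpow_pos_of_pos hs.1 _
    rw [norm_mul, fracSeries_eq c β hs.1, norm_mul, Real.norm_of_nonneg h1.le,
      Real.norm_of_nonneg h2.le]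
    calc _ ≤ fracKernel a (t - s) * (s ^ (β - 1) * C) := by
          gcongr
          exact hC s ⟨hs.1.le, hs.2.le⟩
      _ = _ := by
          rw [fracKernel.eq_def β]
          field_simp

end Subdiffusion

namespace Subdiffusion

/-! ### The relaxation functions -/

/-- The function `t^(β-1) E_{ρ,β}(-λ t^ρ)`. -/
noncomputable def relaxation (ρ lam β t : ℝ) : ℝ := fracSeries ρ (fun n => (-lam) ^ n) β t

theorem geomBound_pow {lam : ℝ} (hl : 0 ≤ lam) : GeomBound (fun n => (-lam) ^ n) lam :=
  ⟨hl, fun n => by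
    rw [abs_pow, abs_neg, abs_of_nonneg hl]
    exact le_mul_of_one_le_left (by positivity) (by linarith [n.cast_nonneg (α := ℝ)])⟩

/-- These are the coefficients of the series for `t r(t)`; they are the reason for the factor `n +
1` in `GeomBound`. -/
theorem geomBound_pow_mul {lam : ℝ} (hl : 0 ≤ lam) :
    GeomBound (fun n => (n + 1) * (-lam) ^ n) lam :=
  ⟨hl, fun n => by
    rw [abs_mul, abs_pow, abs_neg, abs_of_nonneg hl,
      abs_of_nonneg (by positivity : (0 : ℝ) ≤ n + 1)]⟩

theorem relaxation_eq {ρ : ℝ} (lam β : ℝ) {t : ℝ} (ht : 0 < t) :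
    relaxation ρ lam β t
      = t ^ (β - 1) * ∑' n : ℕ, (-lam) ^ n * ((t ^ ρ) ^ n / Real.Gamma (ρ * n + β)) :=
  fracSeries_eq _ β ht

theorem mittagLeffler_eq_relaxation (ρ lam : ℝ) {t : ℝ} (ht : 0 < t) :
    mittagLeffler ρ (-lam * t ^ ρ) = relaxation ρ lam 1 t := by
  rw [relaxation_eq lam 1 ht, sub_self, Real.rpow_zero, one_mul, mittagLeffler]
  exact tsum_congr fun n => by rw [mul_pow, mul_div_assoc]

theorem continuous_mittagLeffler {ρ : ℝ} (hρ : 0 < ρ) : Continuous (mittagLeffler ρ) := by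
  have h : GeomBound (fun _ => 1) 1 := ⟨zero_le_one, fun n => by simp⟩
  have h' := h.continuous hρ (β := 1) one_pos
  simp only [one_mul] at h'
  exact h'

theorem mittagLeffler_zero (ρ : ℝ) : mittagLeffler ρ 0 = 1 := by
  rw [mittagLeffler, tsum_eq_single 0]
  · simp
  · intro n hn
    simp [hn]

theorem continuousOn_relaxation {ρ lam β : ℝ} (hρ : 0 < ρ) (hl : 0 ≤ lam) (hβ : 0 < β) :
    ContinuousOn (relaxation ρ lam β) (Ioi 0) :=
  (geomBound_pow hl).continuousOn_fracSeries hρ hβ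

theorem setIntegral_relaxation {ρ lam β a t : ℝ} (hρ : 0 < ρ) (hl : 0 ≤ lam) (hβ : 0 < β)
    (ha : 0 < a) (ht : 0 < t) :
    ∫ s in Ioo 0 t, fracKernel a (t - s) * relaxation ρ lam β s = relaxation ρ lam (β + a) t :=
  (geomBound_pow hl).setIntegral_conv hρ hβ ha ht

theorem integrableOn_relaxation {ρ lam β a t : ℝ} (hρ : 0 < ρ) (hl : 0 ≤ lam) (hβ : 0 < β)
    (ha : 0 < a) (ht : 0 < t) :
    IntegrableOn (fun s => fracKernel a (t - s) * relaxation ρ lam β s) (Ioo 0 t) :=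
  (geomBound_pow hl).integrableOn_conv hρ hβ ha ht

/-- Splitting off the term `n = 0` and shifting the index. As raising `β` by `ρ` is convolution with
`k_ρ`, this is the Volterra equation of the relaxation functions. -/
theorem relaxation_add {ρ lam β t : ℝ} (hρ : 0 < ρ) (hl : 0 ≤ lam) (hβ : 0 < β) (ht : 0 < t) :
    relaxation ρ lam β t + lam * relaxation ρ lam (β + ρ) t = fracKernel β t := by
  have h := (geomBound_pow hl).summable_fracKernel hρ hβ ht
  rw [relaxation, fracSeries, h.tsum_eq_zero_add, relaxation, fracSeries, ← tsum_mul_left]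
  have h2 : ∀ n : ℕ, (-lam) ^ (n + 1) * fracKernel (ρ * ((n + 1 : ℕ) : ℝ) + β) t
      = -(lam * ((-lam) ^ n * fracKernel (ρ * n + (β + ρ)) t)) := fun n => by
    rw [show ρ * ((n + 1 : ℕ) : ℝ) + β = ρ * n + (β + ρ) by push_cast; ring]
    ring
  simp_rw [h2, tsum_neg]
  simp

/-- The kernel of order one is constant, so raising `β` by one is integration from `0`, and the
fundamental theorem of calculus applies. -/
theorem hasDerivAt_relaxation_add_one {ρ lam β t : ℝ} (hρ : 0 < ρ) (hl : 0 ≤ lam) (hβ : 0 < β)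
    (ht : 0 < t) : HasDerivAt (relaxation ρ lam (β + 1)) (relaxation ρ lam β t) t := by
  have hint : ∀ s, 0 < s → IntervalIntegrable (relaxation ρ lam β) volume 0 s := fun s hs => by
    rw [intervalIntegrable_iff_integrableOn_Ioo_of_le hs.le]
    simpa [fracKernel_one] using integrableOn_relaxation hρ hl hβ one_pos hs
  have hco := continuousOn_relaxation hρ hl hβ
  have h := intervalIntegral.integral_hasDerivAt_right (hint t ht)
    (hco.stronglyMeasurableAtFilter isOpen_Ioi t ht)
    (hco.continuousAt (Ioi_mem_nhds ht))
  refine h.congr_of_eventuallyEq ?_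
  filter_upwards [Ioi_mem_nhds ht] with s hs
  have := setIntegral_relaxation hρ hl hβ one_pos hs
  simp only [fracKernel_one, one_mul] at this
  rw [← this, intervalIntegral.integral_of_le (le_of_lt hs), integral_Ioc_eq_integral_Ioo]

theorem relaxation_one {ρ lam t : ℝ} (hρ : 0 < ρ) (hl : 0 ≤ lam) (ht : 0 < t) :
    relaxation ρ lam 1 t = 1 - lam * relaxation ρ lam (ρ + 1) t := by
  rw [eq_sub_iff_add_eq, add_comm ρ 1, relaxation_add hρ hl one_pos ht, fracKernel_one]

theorem hasDerivAt_relaxation_one {ρ lam t : ℝ} (hρ : 0 < ρ) (hl : 0 ≤ lam) (ht : 0 < t) :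
    HasDerivAt (relaxation ρ lam 1) (-lam * relaxation ρ lam ρ t) t := by
  have h := ((hasDerivAt_relaxation_add_one hρ hl hρ ht).const_mul lam).const_sub 1
  rw [← neg_mul] at h
  refine h.congr_of_eventuallyEq ?_
  filter_upwards [Ioi_mem_nhds ht] with s hs
  exact relaxation_one hρ hl hs

/-! ### Positivity of the resolvent -/

theorem fracKernel_sub_le {ρ s t₁ t₀ : ℝ} (hρ : ρ ∈ Ioo (0 : ℝ) 1) (hs : 0 < s) (h1 : s < t₁)
    (h0 : t₁ < t₀) :
    fracKernel ρ (t₀ - s) ≤ fracKernel ρ t₀ / fracKernel ρ t₁ * fracKernel ρ (t₁ - s) := by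
  have hΓ := Real.Gamma_pos_of_pos hρ.1
  have ht1 : 0 < t₁ := hs.trans h1
  have ht0 : 0 < t₀ := ht1.trans h0
  have ha : 0 < t₁ - s := sub_pos.2 h1
  have hb : 0 < t₀ - s := by linarith
  -- By log-convexity the ratio `k_ρ(t₀ - s) / k_ρ(t₁ - s)` decreases in `s`, so its value at `s =
  -- 0` bounds it.
  have key : ((t₀ - s) * t₁) ^ (ρ - 1) ≤ (t₀ * (t₁ - s)) ^ (ρ - 1) := by
    refine Real.rpow_le_rpow_of_nonpos (by positivity) ?_ (by linarith [hρ.2])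
    nlinarith
  rw [Real.mul_rpow hb.le ht1.le, Real.mul_rpow ht0.le ha.le] at key
  have h1p : 0 < t₁ ^ (ρ - 1) := Real.rpow_pos_of_pos ht1 _
  simp only [fracKernel]
  rw [div_div_div_cancel_right₀ hΓ.ne', div_mul_div_comm, div_le_div_iff₀ hΓ (by positivity)]
  nlinarith

/-- The resolvent of the kernel `λ t^(ρ-1) / Γ(ρ)` is positive: since the kernel is log-convex, the
resolvent has no first zero. -/
theorem relaxation_pos {ρ lam t : ℝ} (hρ : ρ ∈ Ioo (0 : ℝ) 1) (hl : 0 ≤ lam) (ht : 0 < t) :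
    0 < relaxation ρ lam ρ t := by
  set r := relaxation ρ lam ρ with hr
  have hco : ContinuousOn r (Ioi 0) := continuousOn_relaxation hρ.1 hl hρ.1
  have hint : ∀ {a s}, 0 < a → 0 < s →
      IntegrableOn (fun x => fracKernel a (s - x) * r x) (Ioo 0 s) := fun ha hs =>
    integrableOn_relaxation hρ.1 hl hρ.1 ha hs
  have hvol : ∀ s, 0 < s →
      r s = fracKernel ρ s - lam * ∫ x in Ioo 0 s, fracKernel ρ (s - x) * r x := fun s hs => by
    rw [setIntegral_relaxation hρ.1 hl hρ.1 hρ.1 hs, eq_sub_iff_add_eq,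
      relaxation_add hρ.1 hl hρ.1 hs]
  -- Near `0` the factor multiplying `s^{ρ-1}` is close to `1/Γ(ρ) > 0`.
  obtain ⟨δ, hδ, hδpos⟩ : ∃ δ > 0, ∀ s ∈ Ioo 0 δ, 0 < r s := by
    set F : ℝ → ℝ := fun s => ∑' n : ℕ, (-lam) ^ n * ((s ^ ρ) ^ n / Real.Gamma (ρ * n + ρ)) with hF
    have hFc : Continuous F := ((geomBound_pow hl).continuous hρ.1 hρ.1).comp
      (Real.continuous_rpow_const hρ.1.le)
    have hF0 : 0 < F 0 := by
      simp only [hF, Real.zero_rpow hρ.1.ne']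
      rw [tsum_eq_single 0 fun n hn => by simp [hn]]
      simpa using Real.Gamma_pos_of_pos hρ.1
    obtain ⟨δ, hδ, h⟩ := Metric.eventually_nhds_iff.1 (hFc.continuousAt.eventually (lt_mem_nhds hF0))
    refine ⟨δ, hδ, fun s hs => ?_⟩
    rw [hr, relaxation_eq lam ρ hs.1]
    refine mul_pos (Real.rpow_pos_of_pos hs.1 _) (h ?_)
    rw [Real.dist_eq, sub_zero, abs_of_pos hs.1]
    exact hs.2
  by_contra! hneg
  -- Starting at `δ / 2` keeps the set away from the singularity at `0`, so that it is closed and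
  -- has a least element, the first point where `r` fails to be positive.
  set S : Set ℝ := {s | s ∈ Icc (δ / 2) t ∧ r s ≤ 0} with hS
  have hIcc : Icc (δ / 2) t ⊆ Ioi 0 := fun s hs => lt_of_lt_of_le (half_pos hδ) hs.1
  have hScl : IsClosed S :=
    (hco.mono hIcc).preimage_isClosed_of_isClosed isClosed_Icc isClosed_Iic
  have htδ : δ ≤ t := by
    by_contra! h
    exact (hδpos t ⟨ht, h⟩).not_ge hneg
  have hSne : S.Nonempty := ⟨t, ⟨by linarith, le_rfl⟩, hneg⟩
  have hSb : BddBelow S := ⟨δ / 2, fun s hs => hs.1.1⟩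
  set t₀ := sInf S with ht0def
  have ht0S : t₀ ∈ S := hScl.csInf_mem hSne hSb
  have hpos : ∀ s, 0 < s → s < t₀ → 0 < r s := fun s hs hst => by
    by_contra! h
    rcases lt_or_ge s (δ / 2) with h1 | h1
    · exact (hδpos s ⟨hs, by linarith⟩).not_ge h
    · exact hst.not_ge (csInf_le hSb ⟨⟨h1, hst.le.trans ht0S.1.2⟩, h⟩)
  have ht0 : 0 < t₀ := hIcc ht0S.1
  -- The point `p` is so close to `t₀` that the kernel on `[p, t₀]` has mass below `1/2` after
  -- multiplication by `λ`, and `p ≥ t₀ / 2` will give `q ≥ 1/2`.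
  obtain ⟨p, hp0, hpt, hphalf, hpsmall⟩ : ∃ p, 0 < p ∧ p < t₀ ∧ t₀ / 2 ≤ p ∧
      lam * fracKernel (ρ + 1) (t₀ - p) < 1 / 2 := by
    have hc : Continuous fun p : ℝ => lam * fracKernel (ρ + 1) (t₀ - p) := by
      simp only [fracKernel, add_sub_cancel_right]
      exact continuous_const.mul (((Real.continuous_rpow_const hρ.1.le).comp
        (continuous_const.sub continuous_id)).div_const _)
    have h0 : lam * fracKernel (ρ + 1) (t₀ - t₀) < 1 / 2 := by
      simp [fracKernel, Real.zero_rpow hρ.1.ne']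
    have hev := (hc.continuousAt (x := t₀)).eventually (gt_mem_nhds h0)
    have hev2 : ∀ᶠ p in 𝓝[<] t₀, p ∈ Ioo (t₀ / 2) t₀ := Ioo_mem_nhdsLT (by linarith)
    obtain ⟨p, hp1, hp2⟩ := (hev2.and (hev.filter_mono nhdsWithin_le_nhds)).exists
    exact ⟨p, by linarith [hp1.1], hp1.2, hp1.1.le, hp2⟩
  -- The Volterra equation at `t₀` is compared with the one at the maximum point `t₁` of `r` on `[p,
  -- t₀]`. Up to `t₁` the two kernels are compared through `q`; beyond `t₁`, `r` is bounded by `r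
  -- t₁`.
  obtain ⟨t₁, ht1, hmax⟩ := isCompact_Icc.exists_isMaxOn (nonempty_Icc.2 hpt.le)
    (hco.mono fun s hs => lt_of_lt_of_le hp0 hs.1)
  have hr1 : 0 < r t₁ := (hpos p hp0 hpt).trans_le (hmax ⟨le_rfl, hpt.le⟩)
  have ht1pos : 0 < t₁ := hp0.trans_le ht1.1
  have ht10 : t₁ < t₀ := lt_of_le_of_ne ht1.2 fun h => by
    rw [h] at hr1
    exact hr1.not_ge ht0S.2
  set q := fracKernel ρ t₀ / fracKernel ρ t₁ with hq
  have hk1 := fracKernel_pos hρ.1 ht1pos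
  have hqhalf : 1 / 2 ≤ q := by
    have hΓ := Real.Gamma_pos_of_pos hρ.1
    have hrat : 1 ≤ t₀ / t₁ := (one_le_div ht1pos).2 ht10.le
    have : q = (t₀ / t₁) ^ (ρ - 1) := by
      rw [hq, fracKernel, fracKernel, div_div_div_cancel_right₀ hΓ.ne',
        Real.div_rpow ht0.le ht1pos.le]
    rw [this]
    calc (1 / 2 : ℝ) ≤ (t₀ / t₁) ^ (-1 : ℝ) := by
          rw [Real.rpow_neg_one, inv_div, div_le_div_iff₀ two_pos ht0]
          linarith [ht1.1]
      _ ≤ _ := Real.rpow_le_rpow_of_exponent_le hrat (by linarith [hρ.1])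
  have hsplit : ∫ x in Ioo 0 t₀, fracKernel ρ (t₀ - x) * r x
      = (∫ x in Ioo 0 t₁, fracKernel ρ (t₀ - x) * r x)
        + ∫ x in Ico t₁ t₀, fracKernel ρ (t₀ - x) * r x := by
    rw [← Ioo_union_Ico_eq_Ioo ht1pos ht10.le]
    refine setIntegral_union ?_ measurableSet_Ico ?_ ?_
    · exact disjoint_left.2 fun x hx hx' => hx.2.not_ge hx'.1
    · exact (hint hρ.1 ht0).mono_set (Ioo_subset_Ioo_right ht10.le)
    · exact (hint hρ.1 ht0).mono_set fun x hx => ⟨ht1pos.trans_le hx.1, hx.2⟩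
  have hA : ∫ x in Ioo 0 t₁, fracKernel ρ (t₀ - x) * r x
      ≤ q * ∫ x in Ioo 0 t₁, fracKernel ρ (t₁ - x) * r x := by
    rw [← integral_const_mul]
    refine setIntegral_mono_on ((hint hρ.1 ht0).mono_set (Ioo_subset_Ioo_right ht10.le))
      ((hint hρ.1 ht1pos).const_mul q) measurableSet_Ioo fun x hx => ?_
    rw [← mul_assoc]
    exact mul_le_mul_of_nonneg_right (fracKernel_sub_le hρ hx.1 hx.2 ht10)
      (hpos x hx.1 (hx.2.trans ht10)).le
  have hB : ∫ x in Ico t₁ t₀, fracKernel ρ (t₀ - x) * r x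
      ≤ fracKernel (ρ + 1) (t₀ - p) * r t₁ := by
    have hint2 : ∀ u, u < t₀ → IntegrableOn (fun x => fracKernel ρ (t₀ - x)) (Ioo u t₀) ∧
        ∫ x in Ioo u t₀, fracKernel ρ (t₀ - x) = fracKernel (ρ + 1) (t₀ - u) := fun u hu => by
      have h1 := intervalIntegral_fracKernel hρ.1 one_pos (sub_pos.2 hu)
      have h2 := integrableOn_fracKernel hρ.1 one_pos (sub_pos.2 hu)
      simp only [fracKernel_one, mul_one] at h1 h2
      rw [← intervalIntegrable_iff_integrableOn_Ioo_of_le (sub_pos.2 hu).le] at h2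
      have h3 := h2.comp_sub_right u
      simp only [zero_add, sub_add_cancel, sub_sub_sub_cancel_right] at h3
      refine ⟨(intervalIntegrable_iff_integrableOn_Ioo_of_le hu.le).1 h3, ?_⟩
      have h4 := intervalIntegral.integral_comp_sub_right (fun x => fracKernel ρ (t₀ - u - x)) u
        (a := u) (b := t₀)
      simp only [sub_sub_sub_cancel_right, sub_self] at h4
      rw [← integral_Ioc_eq_integral_Ioo, ← intervalIntegral.integral_of_le hu.le, h4, h1]
    rw [integral_Ico_eq_integral_Ioo]
    calc ∫ x in Ioo t₁ t₀, fracKernel ρ (t₀ - x) * r x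
        ≤ ∫ x in Ioo t₁ t₀, fracKernel ρ (t₀ - x) * r t₁ := by
          refine setIntegral_mono_on ((hint hρ.1 ht0).mono_set (Ioo_subset_Ioo_left ht1pos.le))
            ((hint2 t₁ ht10).1.mul_const _) measurableSet_Ioo fun x hx => ?_
          exact mul_le_mul_of_nonneg_left (hmax ⟨ht1.1.trans hx.1.le, hx.2.le⟩)
            (fracKernel_pos hρ.1 (sub_pos.2 hx.2)).le
      _ = fracKernel (ρ + 1) (t₀ - t₁) * r t₁ := by
          rw [integral_mul_const, (hint2 t₁ ht10).2]
      _ ≤ _ := by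
          refine mul_le_mul_of_nonneg_right ?_ hr1.le
          have hΓ := Real.Gamma_pos_of_pos (add_pos hρ.1 one_pos)
          simp only [fracKernel, add_sub_cancel_right]
          have := Real.rpow_le_rpow (z := ρ) (sub_pos.2 ht10).le
            (by linarith [ht1.1] : t₀ - t₁ ≤ t₀ - p) hρ.1.le
          gcongr
  have hv0 := hvol t₀ ht0
  have hv1 := hvol t₁ ht1pos
  have hqk : q * fracKernel ρ t₁ = fracKernel ρ t₀ := div_mul_cancel₀ _ hk1.ne'
  have hA' := mul_le_mul_of_nonneg_left hA hl
  have hB' := mul_le_mul_of_nonneg_left hB hl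
  have e1 : lam * (q * ∫ x in Ioo 0 t₁, fracKernel ρ (t₁ - x) * r x)
      = fracKernel ρ t₀ - q * r t₁ := by
    -- The equation at `t₁`, multiplied by `q`, reproduces the inhomogeneity `k_ρ(t₀)` exactly. What
    -- is left over is `r t₀ > (q - 1/2) r t₁ ≥ 0`, contrary to the choice of `t₀`.
    linear_combination q * hv1 + hqk
  have e2 : lam * fracKernel (ρ + 1) (t₀ - p) * r t₁ < 1 / 2 * r t₁ :=
    mul_lt_mul_of_pos_right hpsmall hr1
  have e3 : 1 / 2 * r t₁ ≤ q * r t₁ := mul_le_mul_of_nonneg_right hqhalf hr1.le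
  rw [hsplit] at hv0
  have := ht0S.2
  nlinarith

/-! ### Bounds that follow from positivity -/

theorem relaxation_add_nonneg {ρ lam a t : ℝ} (hρ : ρ ∈ Ioo (0 : ℝ) 1) (hl : 0 ≤ lam) (ha : 0 < a)
    (ht : 0 < t) : 0 ≤ relaxation ρ lam (ρ + a) t := by
  rw [← setIntegral_relaxation hρ.1 hl hρ.1 ha ht]
  exact setIntegral_nonneg measurableSet_Ioo fun s hs =>
    mul_nonneg (fracKernel_pos ha (sub_pos.2 hs.2)).le (relaxation_pos hρ hl hs.1).le

theorem relaxation_one_nonneg {ρ lam t : ℝ} (hρ : ρ ∈ Ioo (0 : ℝ) 1) (hl : 0 ≤ lam)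
    (ht : 0 < t) : 0 ≤ relaxation ρ lam 1 t := by
  simpa using relaxation_add_nonneg hρ hl (sub_pos.2 hρ.2) ht

theorem relaxation_one_le_one {ρ lam t : ℝ} (hρ : ρ ∈ Ioo (0 : ℝ) 1) (hl : 0 ≤ lam)
    (ht : 0 < t) : relaxation ρ lam 1 t ≤ 1 := by
  rw [relaxation_one hρ.1 hl ht]
  linarith [mul_nonneg hl (relaxation_add_nonneg hρ hl one_pos ht)]

theorem antitoneOn_relaxation_one {ρ lam : ℝ} (hρ : ρ ∈ Ioo (0 : ℝ) 1) (hl : 0 ≤ lam) :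
    AntitoneOn (relaxation ρ lam 1) (Ioi 0) := by
  refine antitoneOn_of_deriv_nonpos (convex_Ioi 0)
    (continuousOn_relaxation hρ.1 hl one_pos) ?_ ?_
  · rw [interior_Ioi]
    exact fun t ht => (hasDerivAt_relaxation_one hρ.1 hl ht).differentiableAt.differentiableWithinAt
  · rw [interior_Ioi]
    intro t ht
    rw [(hasDerivAt_relaxation_one hρ.1 hl ht).deriv, neg_mul]
    exact neg_nonpos.2 (mul_nonneg hl (relaxation_pos hρ hl ht).le)

theorem setIntegral_fracKernel_const {ρ t : ℝ} (hρ : 0 < ρ) (ht : 0 < t) (c : ℝ) :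
    IntegrableOn (fun s => fracKernel ρ (t - s) * c) (Ioo 0 t) ∧
    ∫ s in Ioo 0 t, fracKernel ρ (t - s) * c = t ^ ρ / Real.Gamma (ρ + 1) * c := by
  have h1 := setIntegral_fracKernel hρ one_pos ht
  have h2 := integrableOn_fracKernel hρ one_pos ht
  simp only [fracKernel_one, mul_one] at h1 h2
  refine ⟨h2.mul_const c, ?_⟩
  rw [integral_mul_const, h1, fracKernel, add_sub_cancel_right]

/-- In `e + λ k_ρ * e = 1` with `e(t) = E_ρ(-λ t^ρ)`, monotonicity replaces `e(s)` by its smallest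
value `e(t)` inside the convolution. -/
theorem mul_rpow_mul_relaxation_one_le {ρ lam t : ℝ} (hρ : ρ ∈ Ioo (0 : ℝ) 1) (hl : 0 ≤ lam)
    (ht : 0 < t) : lam * t ^ ρ * relaxation ρ lam 1 t ≤ Real.Gamma (ρ + 1) := by
  have hΓ := Real.Gamma_pos_of_pos (add_pos hρ.1 one_pos)
  have h1 : lam * (t ^ ρ / Real.Gamma (ρ + 1) * relaxation ρ lam 1 t) ≤ 1 := by
    have h := relaxation_add hρ.1 hl one_pos ht
    rw [fracKernel_one, ← setIntegral_relaxation hρ.1 hl one_pos hρ.1 ht] at h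
    refine le_trans ?_ ((le_add_of_nonneg_left (relaxation_one_nonneg hρ hl ht)).trans h.le)
    refine mul_le_mul_of_nonneg_left ?_ hl
    rw [← (setIntegral_fracKernel_const hρ.1 ht _).2]
    refine setIntegral_mono_on (setIntegral_fracKernel_const hρ.1 ht _).1
      (integrableOn_relaxation hρ.1 hl one_pos hρ.1 ht) measurableSet_Ioo fun s hs => ?_
    exact mul_le_mul_of_nonneg_left (antitoneOn_relaxation_one hρ hl hs.1 ht hs.2.le)
      (fracKernel_pos hρ.1 (sub_pos.2 hs.2)).le
  have h2 := mul_le_mul_of_nonneg_right h1 hΓ.le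
  field_simp at h2
  linarith

theorem relaxation_add_one_le {ρ lam t : ℝ} (hρ : ρ ∈ Ioo (0 : ℝ) 1) (hl : 0 ≤ lam)
    (ht : 0 < t) : relaxation ρ lam (ρ + 1) t ≤ t ^ ρ / Real.Gamma (ρ + 1) := by
  rw [add_comm, ← setIntegral_relaxation hρ.1 hl one_pos hρ.1 ht]
  refine (setIntegral_mono_on (integrableOn_relaxation hρ.1 hl one_pos hρ.1 ht)
    (setIntegral_fracKernel_const hρ.1 ht 1).1 measurableSet_Ioo fun s hs => ?_).trans ?_
  · exact mul_le_mul_of_nonneg_left (relaxation_one_le_one hρ hl hs.1)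
      (fracKernel_pos hρ.1 (sub_pos.2 hs.2)).le
  · rw [(setIntegral_fracKernel_const hρ.1 ht 1).2, mul_one, add_comm]

theorem mul_fracKernel {b t : ℝ} (hb : 0 < b) (ht : 0 < t) :
    t * fracKernel b t = b * fracKernel (b + 1) t := by
  have hΓ := (Real.Gamma_pos_of_pos hb).ne'
  rw [fracKernel, fracKernel, Real.Gamma_add_one hb.ne', add_sub_cancel_right,
    Real.rpow_sub_one ht.ne']
  field_simp

theorem mul_relaxation_eq {ρ : ℝ} (hρ : 0 < ρ) (lam : ℝ) {t : ℝ} (ht : 0 < t) :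
    t * relaxation ρ lam ρ t
      = ρ * fracSeries ρ (fun n => (n + 1) * (-lam) ^ n) (ρ + 1) t := by
  rw [relaxation, fracSeries, fracSeries, ← tsum_mul_left, ← tsum_mul_left]
  refine tsum_congr fun n => ?_
  have h := mul_fracKernel (b := ρ * n + ρ) (by positivity) ht
  rw [add_assoc] at h
  linear_combination (-lam) ^ n * h

/-- The function `t r(t)`, `r` being the resolvent, solves a Volterra equation with the same
kernel. -/
theorem mul_relaxation_add {ρ lam t : ℝ} (hρ : 0 < ρ) (hl : 0 ≤ lam) (ht : 0 < t) :
    t * relaxation ρ lam ρ t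
      + lam * ∫ s in Ioo 0 t, fracKernel ρ (t - s) * (s * relaxation ρ lam ρ s)
      = ρ * relaxation ρ lam (ρ + 1) t := by
  have hc := geomBound_pow_mul hl
  have h1 : ∫ s in Ioo 0 t, fracKernel ρ (t - s) * (s * relaxation ρ lam ρ s)
      = ρ * fracSeries ρ (fun n => (n + 1) * (-lam) ^ n) (ρ + 1 + ρ) t := by
    rw [← hc.setIntegral_conv hρ (add_pos hρ one_pos) hρ ht, ← integral_const_mul]
    refine setIntegral_congr_fun measurableSet_Ioo fun s hs => ?_
    rw [mul_relaxation_eq hρ lam hs.1]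
    ring
  -- After removal of the factor `ρ` the coefficients match by `(n + 2)(-λ)^{n+1} + λ (n + 1)(-λ)^n
  -- = (-λ)^{n+1}`.
  rw [h1, mul_relaxation_eq hρ lam ht, mul_left_comm, ← mul_add]
  congr 1
  have hs1 := hc.summable_fracKernel hρ (add_pos hρ one_pos) ht
  have hs2 := (geomBound_pow hl).summable_fracKernel hρ (add_pos hρ one_pos) ht
  have hs3 := hc.summable_fracKernel hρ (by linarith : 0 < ρ + 1 + ρ) ht
  rw [relaxation, fracSeries, fracSeries, fracSeries, ← tsum_mul_left, hs1.tsum_eq_zero_add,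
    hs2.tsum_eq_zero_add, add_assoc, ← Summable.tsum_add ((summable_nat_add_iff 1).2 hs1)
    (hs3.mul_left lam)]
  congr 1
  · simp
  · refine tsum_congr fun n => ?_
    rw [show ρ * ((n + 1 : ℕ) : ℝ) + (ρ + 1) = ρ * n + (ρ + 1 + ρ) by push_cast; ring]
    push_cast
    ring

/-- The convolution term in `mul_relaxation_add` is nonnegative because `r` is, and may be dropped.
-/
theorem mul_relaxation_le {ρ lam t : ℝ} (hρ : ρ ∈ Ioo (0 : ℝ) 1) (hl : 0 ≤ lam) (ht : 0 < t) :
    t * relaxation ρ lam ρ t ≤ ρ * relaxation ρ lam (ρ + 1) t := by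
  rw [← mul_relaxation_add hρ.1 hl ht]
  refine le_add_of_nonneg_right (mul_nonneg hl (setIntegral_nonneg measurableSet_Ioo fun s hs => ?_))
  exact mul_nonneg (fracKernel_pos hρ.1 (sub_pos.2 hs.2)).le
    (mul_nonneg hs.1.le (relaxation_pos hρ hl hs.1).le)

/-- Both bounds come from `λ e_{ρ+1} = 1 - E_ρ(-λ t^ρ)`, where `e_{ρ+1}` is the relaxation function
with `β = ρ + 1`: one from `E_ρ ≥ 0`, the other from integrating `E_ρ ≤ 1` against `k_ρ`. The first
is uniform in `λ`, the second small as `t → 0`; (c) interpolates between them. -/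
theorem mul_mul_relaxation_le_min {ρ lam t : ℝ} (hρ : ρ ∈ Ioo (0 : ℝ) 1) (hl : 0 ≤ lam)
    (ht : 0 < t) :
    t * (lam * relaxation ρ lam ρ t) ≤ min 1 (lam * t ^ ρ / Real.Gamma (ρ + 1)) := by
  have h := mul_le_mul_of_nonneg_left (mul_relaxation_le hρ hl ht) hl
  have h0 := mul_nonneg hl (relaxation_add_nonneg hρ hl one_pos ht)
  have h1 := relaxation_one_nonneg hρ hl ht
  rw [relaxation_one hρ.1 hl ht] at h1
  have h2 := mul_le_mul_of_nonneg_left (relaxation_add_one_le hρ hl ht) hl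
  rw [← mul_div_assoc] at h2
  have h3 : lam * (ρ * relaxation ρ lam (ρ + 1) t) ≤ lam * relaxation ρ lam (ρ + 1) t := by
    nlinarith [hρ.2]
  refine le_min ?_ ?_ <;> nlinarith

theorem min_one_le_rpow {x ε : ℝ} (hx : 0 ≤ x) (hε : ε ∈ Ioc (0 : ℝ) 1) : min 1 x ≤ x ^ ε := by
  rcases le_total 1 x with h | h
  · exact (min_le_left _ _).trans (Real.one_le_rpow h hε.1.le)
  · refine (min_le_right _ _).trans ?_
    simpa using Real.rpow_le_rpow_of_exponent_ge' hx h hε.1.le hε.2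

/-- The derivative of `E_ρ(-λ t^ρ)` is bounded by `C λ^ε t^(ρε-1)` for all `0 < ε ≤ 1`. -/
theorem mul_relaxation_le_rpow {ρ lam t ε : ℝ} (hρ : ρ ∈ Ioo (0 : ℝ) 1) (hl : 0 ≤ lam)
    (ht : 0 < t) (hε : ε ∈ Ioc (0 : ℝ) 1) :
    lam * relaxation ρ lam ρ t
      ≤ (Real.Gamma (ρ + 1))⁻¹ ^ ε * lam ^ ε * t ^ (ρ * ε - 1) := by
  have hΓ := Real.Gamma_pos_of_pos (add_pos hρ.1 one_pos)
  have htρ := Real.rpow_pos_of_pos ht ρ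
  have h := (mul_mul_relaxation_le_min hρ hl ht).trans (min_one_le_rpow (by positivity) hε)
  rw [div_eq_inv_mul, Real.mul_rpow (by positivity) (by positivity),
    Real.mul_rpow hl htρ.le, ← Real.rpow_mul ht.le] at h
  rw [Real.rpow_sub_one ht.ne', mul_div_assoc', le_div_iff₀ ht]
  linarith

/-! ### Bounds for the Mittag-Leffler function -/

theorem mittagLeffler_mem_Icc {ρ lam t : ℝ} (hρ : ρ ∈ Ioo (0 : ℝ) 1) (hl : 0 ≤ lam)
    (ht : 0 ≤ t) : mittagLeffler ρ (-lam * t ^ ρ) ∈ Icc (0 : ℝ) 1 := by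
  rcases ht.eq_or_lt with rfl | ht
  · rw [Real.zero_rpow hρ.1.ne', mul_zero, mittagLeffler_zero]
    simp
  · rw [mittagLeffler_eq_relaxation ρ lam ht]
    exact ⟨relaxation_one_nonneg hρ hl ht, relaxation_one_le_one hρ hl ht⟩

theorem mul_mittagLeffler_le {ρ lam t : ℝ} (hρ : ρ ∈ Ioo (0 : ℝ) 1) (hl : 0 ≤ lam)
    (ht : 0 < t) :
    lam * mittagLeffler ρ (-lam * t ^ ρ) ≤ Real.Gamma (ρ + 1) * (t ^ ρ)⁻¹ := by
  rw [mittagLeffler_eq_relaxation ρ lam ht, ← div_eq_mul_inv,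
    le_div_iff₀ (Real.rpow_pos_of_pos ht _)]
  linarith [mul_rpow_mul_relaxation_one_le hρ hl ht]

theorem hasDerivAt_mittagLeffler {ρ lam t : ℝ} (hρ : ρ ∈ Ioo (0 : ℝ) 1) (hl : 0 ≤ lam)
    (ht : 0 < t) :
    HasDerivAt (fun t => mittagLeffler ρ (-lam * t ^ ρ)) (-lam * relaxation ρ lam ρ t) t := by
  refine (hasDerivAt_relaxation_one hρ.1 hl ht).congr_of_eventuallyEq ?_
  filter_upwards [Ioi_mem_nhds ht] with s hs
  exact mittagLeffler_eq_relaxation ρ lam hs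

/-- The Caputo derivative of `E_ρ(-λ t^ρ)` is `-λ E_ρ(-λ t^ρ)`. -/
theorem setIntegral_caputo_mittagLeffler {ρ lam t : ℝ} (hρ : ρ ∈ Ioo (0 : ℝ) 1) (hl : 0 ≤ lam)
    (ht : 0 < t) :
    ∫ s in Ioo 0 t, fracKernel (1 - ρ) (t - s) * (-lam * relaxation ρ lam ρ s)
      = -lam * mittagLeffler ρ (-lam * t ^ ρ) := by
  simp_rw [mul_left_comm _ (-lam)]
  rw [integral_const_mul, setIntegral_relaxation hρ.1 hl hρ.1 (sub_pos.2 hρ.2) ht,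
    mittagLeffler_eq_relaxation ρ lam ht, add_sub_cancel]

end Subdiffusion

namespace Subdiffusion

/-! ### The Fourier transform on `L_1 ∩ L_2` -/

open scoped FourierTransform SchwartzMap ContDiff

section L2

variable {V : Type*} [NormedAddCommGroup V] [InnerProductSpace ℝ V] [FiniteDimensional ℝ V]
  [MeasurableSpace V] [BorelSpace V]

theorem continuous_fourierInv {g : V → ℂ} (hg : Integrable g) : Continuous (𝓕⁻ g) := by
  have h : 𝓕⁻ g = fun w => 𝓕 g (-w) := funext fun w => Real.fourierInv_eq_fourier_neg g w
  rw [h]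
  exact (VectorFourier.fourierIntegral_continuous Real.continuous_fourierChar
    (L := innerₗ V) continuous_inner hg).comp continuous_neg

theorem integral_smul_fourierInv {f g : V → ℂ} (hf : Integrable f) (hg : Integrable g) :
    ∫ x, 𝓕⁻ f x • g x = ∫ x, f x • 𝓕⁻ g x := by
  have h := VectorFourier.integral_fourierIntegral_smul_eq_flip (μ := (volume : Measure V))
    (ν := (volume : Measure V)) (L := -innerₗ V) Real.continuous_fourierChar
    (by exact continuous_inner.neg) hf hg
  have hflip : (-innerₗ V).flip = -innerₗ V := by
    ext v w
    simp [real_inner_comm]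
  rw [hflip] at h
  exact h

/-- The inverse Fourier transform on `L_2` is given by the integral for functions that are also
integrable. -/
theorem coeFn_fourierInv_toLp {g : V → ℂ} (h1 : Integrable g) (h2 : MemLp g 2) :
    ((𝓕⁻ (h2.toLp g) : Lp ℂ 2 (volume : Measure V)) : V → ℂ) =ᵐ[volume] 𝓕⁻ g := by
  -- Both sides are tested against smooth compactly supported functions. On the `L_2` side the
  -- transform moves to the test function by its definition on tempered distributions, on the `L_1`
  -- side by Fubini.
  refine ae_eq_of_integral_contDiff_smul_eq
    ((Lp.memLp _).locallyIntegrable (by norm_num))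
    (continuous_fourierInv h1).locallyIntegrable fun ψ hψ hψc => ?_
  have hc : HasCompactSupport (Complex.ofRealCLM ∘ ψ) := hψc.comp_left rfl
  have hd : ContDiff ℝ ∞ (Complex.ofRealCLM ∘ ψ) := by fun_prop
  set s : 𝓢(V, ℂ) := hc.toSchwartzMap hd with hs
  have hsx : ∀ x, s x = (ψ x : ℂ) := fun x => rfl
  have e1 : ∫ x, ψ x • ((𝓕⁻ (h2.toLp g) : Lp ℂ 2 (volume : Measure V)) : V → ℂ) x
      = ((𝓕⁻ (h2.toLp g) : Lp ℂ 2 (volume : Measure V)) : 𝓢'(V, ℂ)) s := by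
    rw [Lp.toTemperedDistribution_apply]
    simp [hsx]
  rw [e1, ← Lp.fourierInv_toTemperedDistribution_eq, TemperedDistribution.fourierInv_apply,
    Lp.toTemperedDistribution_apply]
  have e2 : ∫ x, (𝓕⁻ s) x • (h2.toLp g : V → ℂ) x = ∫ x, 𝓕⁻ (s : V → ℂ) x • g x := by
    refine integral_congr_ae ?_
    filter_upwards [h2.coeFn_toLp] with x hx
    rw [hx, SchwartzMap.fourierInv_coe]
  rw [e2, integral_smul_fourierInv s.integrable h1]
  simp [hsx]

theorem memLp_fourierInv {g : V → ℂ} (h1 : Integrable g) (h2 : MemLp g 2) : MemLp (𝓕⁻ g) 2 :=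
  (memLp_congr_ae (coeFn_fourierInv_toLp h1 h2)).1 (Lp.memLp _)

end L2

section Euclidean

variable {N : ℕ}

local notation "𝔼" => EuclideanSpace ℝ (Fin N)

/-- The inverse Fourier integral `∫ g(ξ) e^{ixξ} dξ`. -/
noncomputable def expIntegral (g : 𝔼 → ℂ) (x : 𝔼) : ℂ :=
  ∫ ξ, g ξ * Complex.exp (Complex.I * ((inner ℝ x ξ : ℝ) : ℂ))

theorem norm_exp_I_mul (r : ℝ) : ‖Complex.exp (Complex.I * (r : ℂ))‖ = 1 := by
  rw [mul_comm]
  exact Complex.norm_exp_ofReal_mul_I r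

theorem integrable_mul_exp {g : 𝔼 → ℂ} (hg : Integrable g) (x : 𝔼) :
    Integrable fun ξ => g ξ * Complex.exp (Complex.I * ((inner ℝ x ξ : ℝ) : ℂ)) := by
  refine hg.norm.mono' (hg.aestronglyMeasurable.mul (by fun_prop)) (Eventually.of_forall fun ξ => ?_)
  rw [norm_mul, norm_exp_I_mul, mul_one]

theorem expIntegral_eq_fourierInv_comp (g : 𝔼 → ℂ) (x : 𝔼) :
    expIntegral g x = 𝓕⁻ g ((2 * Real.pi)⁻¹ • x) := by
  rw [Real.fourierInv_eq', expIntegral]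
  refine integral_congr_ae (Eventually.of_forall fun ξ => ?_)
  have : 2 * Real.pi * inner ℝ ξ ((2 * Real.pi)⁻¹ • x) = inner ℝ x ξ := by
    rw [inner_smul_right, real_inner_comm]
    have := Real.pi_pos.ne'
    field_simp
  simp only
  rw [this, smul_eq_mul, mul_comm, mul_comm Complex.I]

/-- The dilation that relates the two normalisations of the Fourier transform. -/
noncomputable def dilate (g : 𝔼 → ℂ) (η : 𝔼) : ℂ :=
  (((2 * Real.pi) ^ N : ℝ) : ℂ) * g ((2 * Real.pi) • η)

theorem two_pi_ne_zero : (2 * Real.pi : ℝ) ≠ 0 := by positivity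

theorem integrable_dilate {g : 𝔼 → ℂ} (hg : Integrable g) : Integrable (dilate g) :=
  (hg.comp_smul two_pi_ne_zero).const_mul _

theorem aestronglyMeasurable_comp_smul {g : 𝔼 → ℂ} (hg : AEStronglyMeasurable g) {r : ℝ}
    (hr : r ≠ 0) : AEStronglyMeasurable fun η => g (r • η) :=
  hg.comp_quasiMeasurePreserving (Measure.quasiMeasurePreserving_smul volume hr)

theorem memLp_comp_smul {g : 𝔼 → ℂ} (hg : MemLp g 2) {r : ℝ} (hr : r ≠ 0) :
    MemLp (fun η => g (r • η)) 2 := by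
  rw [memLp_two_iff_integrable_sq_norm (aestronglyMeasurable_comp_smul hg.1 hr)]
  exact ((memLp_two_iff_integrable_sq_norm hg.1).1 hg).comp_smul hr

theorem memLp_dilate {g : 𝔼 → ℂ} (hg : MemLp g 2) : MemLp (dilate g) 2 :=
  (memLp_comp_smul hg two_pi_ne_zero).const_mul _

theorem expIntegral_eq_fourierInv_dilate (g : 𝔼 → ℂ) : expIntegral g = 𝓕⁻ (dilate g) := by
  funext x
  rw [Real.fourierInv_eq', expIntegral]
  have h := Measure.integral_comp_smul_of_nonneg (volume : Measure 𝔼)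
    (fun ξ => g ξ * Complex.exp (Complex.I * ((inner ℝ x ξ : ℝ) : ℂ))) (2 * Real.pi)
    (hR := by positivity)
  have hπ : (((2 * Real.pi) ^ N : ℝ) : ℂ) ≠ 0 := by
    exact_mod_cast pow_ne_zero N two_pi_ne_zero
  rw [finrank_euclideanSpace_fin, Complex.real_smul, Complex.ofReal_inv] at h
  rw [eq_inv_mul_iff_mul_eq₀ hπ, ← integral_const_mul] at h
  rw [← h]
  refine integral_congr_ae (Eventually.of_forall fun η => ?_)
  simp only [dilate]
  rw [inner_smul_right, real_inner_comm, smul_eq_mul, mul_comm Complex.I]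
  ring

theorem continuous_expIntegral {g : 𝔼 → ℂ} (hg : Integrable g) : Continuous (expIntegral g) := by
  rw [expIntegral_eq_fourierInv_dilate]
  exact continuous_fourierInv (integrable_dilate hg)

theorem memLp_expIntegral {g : 𝔼 → ℂ} (h1 : Integrable g) (h2 : MemLp g 2) :
    MemLp (expIntegral g) 2 := by
  rw [expIntegral_eq_fourierInv_dilate]
  exact memLp_fourierInv (integrable_dilate h1) (memLp_dilate h2)

theorem fourierL2_of_memLp {f : 𝔼 → ℂ} (h : MemLp f 2) : fourierL2 f = fun ξ =>
    (((2 * Real.pi) ^ N)⁻¹ : ℝ) • ((𝓕 (h.toLp f) : Lp ℂ 2 (volume : Measure 𝔼)) : 𝔼 → ℂ)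
      ((2 * Real.pi)⁻¹ • ξ) := by
  rw [fourierL2, dif_pos h]

theorem memLp_fourierL2 {f : 𝔼 → ℂ} (h : MemLp f 2) : MemLp (fourierL2 f) 2 := by
  rw [fourierL2_of_memLp h]
  exact (memLp_comp_smul (Lp.memLp (𝓕 (h.toLp f) : Lp ℂ 2 (volume : Measure 𝔼)))
    (inv_ne_zero two_pi_ne_zero)).const_smul (((2 * Real.pi) ^ N)⁻¹ : ℝ)

/-- Fourier inversion: the inverse Fourier integral of `g ∈ L_1 ∩ L_2` has transform `g`. -/
theorem fourierL2_expIntegral {g : 𝔼 → ℂ} (h1 : Integrable g) (h2 : MemLp g 2) :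
    fourierL2 (expIntegral g) =ᵐ[volume] g := by
  have hm := memLp_expIntegral h1 h2
  have hd := memLp_dilate h2
  have e : hm.toLp (expIntegral g) = 𝓕⁻ (hd.toLp (dilate g)) := by
    refine Lp.ext (hm.coeFn_toLp.trans ?_)
    rw [expIntegral_eq_fourierInv_dilate]
    exact (coeFn_fourierInv_toLp (integrable_dilate h1) hd).symm
  rw [fourierL2_of_memLp hm, e, FourierTransform.fourier_fourierInv_eq]
  have hq := (Measure.quasiMeasurePreserving_smul (volume : Measure 𝔼)
    (inv_ne_zero two_pi_ne_zero)).ae_eq_comp hd.coeFn_toLp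
  filter_upwards [hq] with ξ hξ
  simp only [Function.comp_apply] at hξ
  have hπ : (((2 * Real.pi) ^ N : ℝ) : ℂ) ≠ 0 := by
    exact_mod_cast pow_ne_zero N two_pi_ne_zero
  rw [hξ, dilate, smul_smul, mul_inv_cancel₀ two_pi_ne_zero, one_smul, Complex.real_smul,
    Complex.ofReal_inv, inv_mul_cancel_left₀ hπ]

/-- Fourier inversion: `f` is the inverse Fourier integral of its transform, if the latter is
integrable. -/
theorem expIntegral_fourierL2 {f : 𝔼 → ℂ} (hf : MemLp f 2) (h1 : Integrable (fourierL2 f)) :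
    expIntegral (fourierL2 f) =ᵐ[volume] f := by
  have h2 := memLp_fourierL2 hf
  have hd := memLp_dilate h2
  -- The dilation cancels the rescaling in `fourierL2` and leaves the unitary transform of `f`.
  have e : hd.toLp (dilate (fourierL2 f)) = 𝓕 (hf.toLp f) := by
    refine Lp.ext (hd.coeFn_toLp.trans (Eventually.of_forall fun η => ?_))
    have hπ : (((2 * Real.pi) ^ N : ℝ) : ℂ) ≠ 0 := by
      exact_mod_cast pow_ne_zero N two_pi_ne_zero
    rw [dilate, fourierL2_of_memLp hf]
    simp only
    rw [smul_smul, inv_mul_cancel₀ two_pi_ne_zero, one_smul, Complex.real_smul,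
      Complex.ofReal_inv, mul_inv_cancel_left₀ hπ]
  have h := coeFn_fourierInv_toLp (integrable_dilate h1) hd
  rw [e, FourierTransform.fourierInv_fourier_eq, ← expIntegral_eq_fourierInv_dilate] at h
  exact h.symm.trans hf.coeFn_toLp

/-- The Riemann-Lebesgue lemma. -/
theorem tendsto_expIntegral_cocompact (g : 𝔼 → ℂ) :
    Tendsto (expIntegral g) (cocompact 𝔼) (𝓝 0) := by
  have h1 : Tendsto (𝓕 (dilate g)) (cocompact 𝔼) (𝓝 0) :=
    tendsto_integral_exp_inner_smul_cocompact (dilate g)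
  have h2 : expIntegral g = 𝓕 (dilate g) ∘ Homeomorph.neg 𝔼 := by
    rw [expIntegral_eq_fourierInv_dilate]
    exact funext fun w => Real.fourierInv_eq_fourier_neg _ w
  rw [h2]
  exact h1.comp (Homeomorph.neg 𝔼).isClosedEmbedding.tendsto_cocompact

/-! ### Differentiation of inverse Fourier integrals -/

/-- The moments of `g` up to the order `M` are finite. -/
def HasMoments (M : ℕ) (g : 𝔼 → ℂ) : Prop :=
  AEStronglyMeasurable g ∧ ∀ k ≤ M, Integrable fun ξ : 𝔼 => ‖ξ‖ ^ k * ‖g ξ‖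

theorem HasMoments.integrable {M : ℕ} {g : 𝔼 → ℂ} (h : HasMoments M g) : Integrable g :=
  (integrable_norm_iff h.1).1 (by simpa using h.2 0 (zero_le))

theorem HasMoments.mono {M M' : ℕ} {g : 𝔼 → ℂ} (h : HasMoments M g) (hM : M' ≤ M) :
    HasMoments M' g := ⟨h.1, fun k hk => h.2 k (hk.trans hM)⟩

theorem HasMoments.coord_mul {M : ℕ} {g : 𝔼 → ℂ} (h : HasMoments (M + 1) g) (j : Fin N) :
    HasMoments M fun ξ => (ξ j : ℂ) * g ξ := by
  have hm : AEStronglyMeasurable fun ξ : 𝔼 => (ξ j : ℂ) * g ξ :=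
    AEStronglyMeasurable.mul (by fun_prop) h.1
  refine ⟨hm, fun k hk => (h.2 (k + 1) (by omega)).mono'
    (AEStronglyMeasurable.mul (by fun_prop) hm.norm) (Eventually.of_forall fun ξ => ?_)⟩
  have hξ : |ξ j| ≤ ‖ξ‖ := by simpa using PiLp.norm_apply_le ξ j
  rw [Real.norm_of_nonneg (by positivity), norm_mul, Complex.norm_real, Real.norm_eq_abs, pow_succ,
    mul_assoc]
  gcongr

theorem partialD_expIntegral {g : 𝔼 → ℂ} (h : HasMoments 1 g) (j : Fin N) :
    partialD j (expIntegral g) = expIntegral fun ξ => (ξ j : ℂ) * g ξ := by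
  funext x
  have hin : ∀ (r : ℝ) (ξ : 𝔼), inner ℝ (x + r • EuclideanSpace.single j (1 : ℝ)) ξ
      = inner ℝ x ξ + r * ξ j := fun r ξ => by
    rw [inner_add_left, inner_smul_left]
    simp [EuclideanSpace.inner_single_left]
  have hd := (hasDerivAt_integral_of_dominated_loc_of_deriv_le (𝕜 := ℝ) (μ := volume) (x₀ := 0)
    (F := fun r ξ => g ξ * Complex.exp (Complex.I *
      ((inner ℝ (x + r • EuclideanSpace.single j (1 : ℝ)) ξ : ℝ) : ℂ)))
    (F' := fun r ξ => g ξ * (Complex.exp (Complex.I *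
      ((inner ℝ (x + r • EuclideanSpace.single j (1 : ℝ)) ξ : ℝ) : ℂ)) * (Complex.I * (ξ j : ℂ))))
    (bound := fun ξ => ‖ξ‖ ^ 1 * ‖g ξ‖) univ_mem
    (Eventually.of_forall fun r => (integrable_mul_exp h.integrable _).1)
    (integrable_mul_exp h.integrable _) (h.1.mul (by fun_prop))
    (Eventually.of_forall fun ξ r _ => ?_) (h.2 1 le_rfl)
    (Eventually.of_forall fun ξ r _ => ?_)).2
  · rw [partialD, lineDeriv]
    have hF : (fun t : ℝ => expIntegral g (x + t • EuclideanSpace.single j (1 : ℝ)))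
      = fun t : ℝ => ∫ ξ, g ξ * Complex.exp (Complex.I *
        ((inner ℝ (x + t • EuclideanSpace.single j (1 : ℝ)) ξ : ℝ) : ℂ)) := rfl
    rw [hF, hd.deriv, ← integral_const_mul, expIntegral]
    refine integral_congr_ae (Eventually.of_forall fun ξ => ?_)
    simp only [zero_smul, add_zero]
    linear_combination (-(ξ j : ℂ) * g ξ * Complex.exp (Complex.I * ((inner ℝ x ξ : ℝ) : ℂ)))
      * Complex.I_mul_I
  · have hξ : |ξ j| ≤ ‖ξ‖ := by simpa using PiLp.norm_apply_le ξ j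
    rw [norm_mul, norm_mul, norm_exp_I_mul, one_mul, norm_mul, Complex.norm_I, one_mul,
      Complex.norm_real, Real.norm_eq_abs, pow_one, mul_comm]
    gcongr
  · refine HasDerivAt.const_mul _ (HasDerivAt.cexp (HasDerivAt.const_mul _ ?_))
    simp_rw [hin]
    have : HasDerivAt (fun r : ℝ => inner ℝ x ξ + r * ξ j) (ξ j) r := by
      simpa using ((hasDerivAt_id r).mul_const (ξ j)).const_add (inner ℝ x ξ)
    exact this.ofReal_comp

theorem iterate_partialD_expIntegral (j : Fin N) (n : ℕ) {M : ℕ} {g : 𝔼 → ℂ}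
    (h : HasMoments (M + n) g) :
    (partialD j)^[n] (expIntegral g) = expIntegral (fun ξ => (ξ j : ℂ) ^ n * g ξ) ∧
      HasMoments M fun ξ => (ξ j : ℂ) ^ n * g ξ := by
  induction n generalizing M with
  | zero => simpa using h
  | succ n ih =>
    obtain ⟨h1, h2⟩ := ih (M := M + 1) (by rwa [add_assoc, add_comm 1 n])
    have e : (fun ξ : 𝔼 => (ξ j : ℂ) * ((ξ j : ℂ) ^ n * g ξ))
        = fun ξ => (ξ j : ℂ) ^ (n + 1) * g ξ := by
      funext ξ
      ring
    have h3 := h2.coord_mul j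
    rw [Function.iterate_succ_apply', h1, partialD_expIntegral (h2.mono (by omega)), e]
    rw [e] at h3
    exact ⟨rfl, h3⟩

theorem foldr_partialD_expIntegral (L : List (Fin N)) (α : Fin N → ℕ) {M : ℕ} {g : 𝔼 → ℂ}
    (h : HasMoments (M + (L.map α).sum) g) :
    L.foldr (fun j f => (partialD j)^[α j] f) (expIntegral g)
      = expIntegral (fun ξ => (L.map fun j => (ξ j : ℂ) ^ α j).prod * g ξ) ∧
      HasMoments M fun ξ => (L.map fun j => (ξ j : ℂ) ^ α j).prod * g ξ := by
  induction L generalizing M with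
  | nil => simpa using h
  | cons j L ih =>
    simp only [List.map_cons, List.sum_cons, List.prod_cons, List.foldr_cons] at h ⊢
    obtain ⟨h1, h2⟩ := ih (M := M + α j) (by rwa [add_assoc])
    rw [h1]
    simpa only [mul_assoc] using iterate_partialD_expIntegral j (α j) h2

theorem multiD_expIntegral (α : Fin N →₀ ℕ) {M : ℕ} {g : 𝔼 → ℂ}
    (h : HasMoments (M + α.degree) g) :
    multiD α (expIntegral g) = expIntegral (fun ξ => (∏ j, (ξ j : ℂ) ^ α j) * g ξ) ∧
      HasMoments M fun ξ => (∏ j, (ξ j : ℂ) ^ α j) * g ξ := by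
  have hdeg : ((List.finRange N).map α).sum = α.degree := by
    rw [Finsupp.degree_eq_sum, ← List.ofFn_eq_map, List.sum_ofFn]
  have := foldr_partialD_expIntegral (List.finRange N) α (M := M) (g := g) (by rwa [hdeg])
  simp only [← List.ofFn_eq_map, List.prod_ofFn] at this
  exact this

theorem contDiff_expIntegral {M : ℕ} {g : 𝔼 → ℂ} (h : HasMoments M g) :
    ContDiff ℝ (M : WithTop ℕ∞) (expIntegral g) := by
  have h1 : ContDiff ℝ ((M : ℕ∞) : WithTop ℕ∞) (𝓕 g) :=
    Real.contDiff_fourier fun n hn => h.2 n (by exact_mod_cast hn)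
  have h2 : expIntegral g = fun x => 𝓕 g (-((2 * Real.pi)⁻¹ • x)) := by
    funext x
    rw [expIntegral_eq_fourierInv_comp, Real.fourierInv_eq_fourier_neg]
  rw [h2]
  exact h1.comp (contDiff_id.const_smul _).neg

theorem diffOp_expIntegral {A : MvPolynomial (Fin N) ℝ} {m : ℕ} (hA : A.IsHomogeneous m)
    {g : 𝔼 → ℂ} (h : HasMoments m g) (x : 𝔼) :
    diffOp A (expIntegral g) x = expIntegral (fun ξ => (symbol A ξ : ℂ) * g ξ) x := by
  have hα : ∀ α ∈ A.support, multiD α (expIntegral g) =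
      expIntegral (fun ξ => (∏ j, (ξ j : ℂ) ^ α j) * g ξ) ∧
      HasMoments 0 fun ξ => (∏ j, (ξ j : ℂ) ^ α j) * g ξ := fun α hα => by
    refine multiD_expIntegral α (h.mono ?_)
    rw [zero_add, Finsupp.degree_eq_weight_one]
    exact (hA (MvPolynomial.mem_support_iff.1 hα)).le
  rw [diffOp, expIntegral]
  calc ∑ α ∈ A.support, ((A.coeff α : ℝ) : ℂ) * multiD α (expIntegral g) x
      = ∑ α ∈ A.support, ∫ ξ, ((A.coeff α : ℝ) : ℂ) * ((∏ j, (ξ j : ℂ) ^ α j) * g ξ *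
          Complex.exp (Complex.I * ((inner ℝ x ξ : ℝ) : ℂ))) := by
        refine Finset.sum_congr rfl fun α h => ?_
        rw [(hα α h).1, expIntegral, integral_const_mul]
    _ = _ := by
        rw [← integral_finsetSum _ fun α h =>
          (integrable_mul_exp (hα α h).2.integrable x).const_mul _]
        refine integral_congr_ae (Eventually.of_forall fun ξ => ?_)
        simp only [symbol, MvPolynomial.eval_eq']
        push_cast
        rw [Finset.sum_mul, Finset.sum_mul]
        exact Finset.sum_congr rfl fun α _ => by ring

end Euclidean

end Subdiffusion

namespace Subdiffusion

section Euclidean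

variable {N : ℕ}

local notation "𝔼" => EuclideanSpace ℝ (Fin N)

/-! ### The symbol -/

theorem continuous_symbol (A : MvPolynomial (Fin N) ℝ) : Continuous (symbol A) :=
  (MvPolynomial.continuous_eval A).comp (by fun_prop)

theorem prod_abs_pow_le (α : Fin N →₀ ℕ) (ξ : 𝔼) : ∏ j, |ξ j| ^ α j ≤ ‖ξ‖ ^ α.degree := by
  rw [Finsupp.degree_eq_sum, ← Finset.prod_pow_eq_pow_sum]
  refine Finset.prod_le_prod (fun j _ => by positivity) fun j _ => ?_
  have : |ξ j| ≤ ‖ξ‖ := by simpa using PiLp.norm_apply_le ξ j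
  gcongr

theorem degree_eq_of_mem_support {A : MvPolynomial (Fin N) ℝ} {m : ℕ} (hA : A.IsHomogeneous m)
    {α : Fin N →₀ ℕ} (hα : α ∈ A.support) : α.degree = m := by
  rw [Finsupp.degree_eq_weight_one]
  exact hA (MvPolynomial.mem_support_iff.1 hα)

theorem abs_symbol_le {A : MvPolynomial (Fin N) ℝ} {m : ℕ} (hA : A.IsHomogeneous m) (ξ : 𝔼) :
    |symbol A ξ| ≤ (∑ α ∈ A.support, |A.coeff α|) * ‖ξ‖ ^ m := by
  rw [symbol, MvPolynomial.eval_eq', Finset.sum_mul]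
  refine (Finset.abs_sum_le_sum_abs _ _).trans (Finset.sum_le_sum fun α hα => ?_)
  rw [abs_mul, Finset.abs_prod, ← degree_eq_of_mem_support hA hα]
  simp_rw [abs_pow]
  gcongr
  exact prod_abs_pow_le α ξ

theorem symbol_smul {A : MvPolynomial (Fin N) ℝ} {m : ℕ} (hA : A.IsHomogeneous m) (r : ℝ)
    (ξ : 𝔼) : symbol A (r • ξ) = r ^ m * symbol A ξ := by
  rw [symbol, symbol, MvPolynomial.eval_eq', MvPolynomial.eval_eq', Finset.mul_sum]
  refine Finset.sum_congr rfl fun α hα => ?_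
  rw [← degree_eq_of_mem_support hA hα, Finsupp.degree_eq_sum, ← Finset.prod_pow_eq_pow_sum,
    mul_left_comm, ← Finset.prod_mul_distrib]
  simp [mul_pow]

variable {A : MvPolynomial (Fin N) ℝ} {l : ℕ}

theorem IsHomogeneousElliptic.symbol_nonneg (hA : IsHomogeneousElliptic A l) (hl : 0 < l)
    (ξ : 𝔼) : 0 ≤ symbol A ξ := by
  rcases eq_or_ne ξ 0 with rfl | h
  · have := symbol_smul hA.homogeneous 0 (0 : 𝔼)
    rw [zero_pow (by omega), zero_mul, smul_zero] at this
    exact this.ge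
  · exact (hA.elliptic ξ h).le

/-- The symbol is bounded below on the compact unit sphere, and homogeneity carries the bound to all
`ξ`. -/
theorem IsHomogeneousElliptic.norm_pow_le (hA : IsHomogeneousElliptic A l) (hl : 0 < l) :
    ∃ C, 0 ≤ C ∧ ∀ ξ : 𝔼, ‖ξ‖ ^ (2 * l) ≤ C * symbol A ξ := by
  have hpos : ∀ ξ ∈ Metric.sphere (0 : 𝔼) 1, symbol A ξ ≠ 0 := fun ξ hξ =>
    (hA.elliptic ξ (ne_zero_of_mem_unit_sphere ⟨ξ, hξ⟩)).ne'
  obtain ⟨C, hC⟩ := (isCompact_sphere (0 : 𝔼) 1).exists_bound_of_continuousOn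
    (f := fun ξ => (symbol A ξ)⁻¹) ((continuous_symbol A).continuousOn.inv₀ hpos)
  refine ⟨max C 0, le_max_right _ _, fun ξ => ?_⟩
  have hnn := hA.symbol_nonneg hl
  rcases eq_or_ne ξ 0 with rfl | h
  · rw [norm_zero, zero_pow (by omega)]
    exact mul_nonneg (le_max_right _ _) (hnn 0)
  · have hn : 0 < ‖ξ‖ := norm_pos_iff.2 h
    have hmem : ‖ξ‖⁻¹ • ξ ∈ Metric.sphere (0 : 𝔼) 1 := by
      simp [norm_smul, hn.ne']
    have h1 := hC _ hmem
    have h2 : 0 < symbol A (‖ξ‖⁻¹ • ξ) := lt_of_le_of_ne (hnn _) (hpos _ hmem).symm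
    rw [norm_inv, Real.norm_of_nonneg h2.le] at h1
    have h3 : 1 ≤ C * symbol A (‖ξ‖⁻¹ • ξ) := (inv_le_iff_one_le_mul₀ h2).1 h1
    rw [symbol_smul hA.homogeneous, inv_pow] at h3
    have hp : 0 < ‖ξ‖ ^ (2 * l) := pow_pos hn _
    have h4 : ‖ξ‖ ^ (2 * l) ≤ C * symbol A ξ := by
      calc ‖ξ‖ ^ (2 * l) = ‖ξ‖ ^ (2 * l) * 1 := (mul_one _).symm
        _ ≤ ‖ξ‖ ^ (2 * l) * (C * ((‖ξ‖ ^ (2 * l))⁻¹ * symbol A ξ)) := by gcongr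
        _ = C * symbol A ξ := by field_simp
    exact h4.trans (mul_le_mul_of_nonneg_right (le_max_left _ _) (hnn ξ))

/-! ### Integrability of the transform of the initial value -/

/-- Cauchy-Schwarz, in the pointwise form `ab ≤ a² + b²`, with `a = p^{τ/2} |φ̂|` and `b =
p^{σ-τ/2}`, `p = 1 + |ξ|²`. The hypothesis on `σ` says that `b²` is integrable. -/
theorem MemSobolevClass.integrable_weight {τ σ : ℝ} {φ : 𝔼 → ℂ} (hφ : MemSobolevClass τ φ)
    (hσ : (N : ℝ) / 2 < τ - 2 * σ) :
    Integrable fun ξ : 𝔼 => (1 + ‖ξ‖ ^ 2) ^ σ * ‖fourierL2 φ ξ‖ := by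
  have h1 := hφ.2
  have h2 : Integrable fun ξ : 𝔼 => ((1 : ℝ) + ‖ξ‖ ^ 2) ^ (-(2 * (τ - 2 * σ)) / 2) :=
    integrable_rpow_neg_one_add_norm_sq (by rw [finrank_euclideanSpace_fin]; linarith)
  refine (h1.add h2).mono' ?_ (Eventually.of_forall fun ξ => ?_)
  · exact AEStronglyMeasurable.mul (Measurable.aestronglyMeasurable (by fun_prop))
      (memLp_fourierL2 hφ.1).1.norm
  · set p := (1 : ℝ) + ‖ξ‖ ^ 2 with hp
    have hp0 : 0 < p := by positivity
    have e1 : p ^ τ = (p ^ (τ / 2)) ^ 2 := by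
      rw [← Real.rpow_natCast, ← Real.rpow_mul hp0.le]
      congr 1
      push_cast
      ring
    have e2 : p ^ (-(2 * (τ - 2 * σ)) / 2) = (p ^ (σ - τ / 2)) ^ 2 := by
      rw [← Real.rpow_natCast, ← Real.rpow_mul hp0.le]
      congr 1
      push_cast
      ring
    have e3 : p ^ σ = p ^ (τ / 2) * p ^ (σ - τ / 2) := by
      rw [← Real.rpow_add hp0]
      congr 1
      ring
    rw [Real.norm_of_nonneg (by positivity), Pi.add_apply, e1, e2, e3]
    nlinarith [sq_nonneg (p ^ (τ / 2) * ‖fourierL2 φ ξ‖ - p ^ (σ - τ / 2)),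
      sq_nonneg (p ^ (τ / 2) * ‖fourierL2 φ ξ‖), sq_nonneg (p ^ (σ - τ / 2))]

theorem MemSobolevClass.integrable_fourierL2 {τ : ℝ} {φ : 𝔼 → ℂ} (hφ : MemSobolevClass τ φ)
    (hτ : (N : ℝ) / 2 < τ) : Integrable (fourierL2 φ) := by
  refine (integrable_norm_iff (memLp_fourierL2 hφ.1).1).1 ?_
  simpa using hφ.integrable_weight (σ := 0) (by linarith)

theorem MemSobolevClass.exists_integrable_symbol_rpow (hA : IsHomogeneousElliptic A l)
    (hl : 0 < l) {τ : ℝ} {φ : 𝔼 → ℂ} (hφ : MemSobolevClass τ φ) (hτ : (N : ℝ) / 2 < τ) :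
    ∃ ε ∈ Ioc (0 : ℝ) 1, Integrable fun ξ : 𝔼 => symbol A ξ ^ ε * ‖fourierL2 φ ξ‖ := by
  have hl' : (0 : ℝ) < l := by exact_mod_cast hl
  -- Since `A(ξ)^ε` grows at most like `(1 + |ξ|²)^{lε}`, one needs `2lε < τ - N/2`; the denominator
  -- `4l` makes the inequality strict.
  set ε := min 1 ((τ - N / 2) / (4 * l)) with hε
  have hε0 : 0 < ε := lt_min one_pos (div_pos (by linarith) (by positivity))
  have hεl : ε * (4 * l) ≤ τ - N / 2 :=
    (le_div_iff₀ (by positivity)).1 (min_le_right _ _)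
  refine ⟨ε, ⟨hε0, min_le_left _ _⟩, ?_⟩
  set C := ∑ α ∈ A.support, |A.coeff α| with hC
  have hC0 : 0 ≤ C := Finset.sum_nonneg fun _ _ => abs_nonneg _
  refine ((hφ.integrable_weight (σ := l * ε) (by linarith)).const_mul (C ^ ε)).mono' ?_
    (Eventually.of_forall fun ξ => ?_)
  · exact ((continuous_symbol A).rpow_const fun _ =>
      Or.inr hε0.le).aestronglyMeasurable.mul (memLp_fourierL2 hφ.1).1.norm
  · have h0 := hA.symbol_nonneg hl ξ
    have h1 : symbol A ξ ≤ C * (1 + ‖ξ‖ ^ 2) ^ l := by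
      refine (le_abs_self _).trans ((abs_symbol_le hA.homogeneous ξ).trans ?_)
      rw [pow_mul]
      gcongr
      linarith
    rw [Real.norm_of_nonneg (by positivity), ← mul_assoc]
    gcongr
    calc symbol A ξ ^ ε ≤ (C * (1 + ‖ξ‖ ^ 2) ^ l) ^ ε := by gcongr
      _ = C ^ ε * (1 + ‖ξ‖ ^ 2) ^ ((l : ℝ) * ε) := by
        rw [Real.mul_rpow hC0 (by positivity), Real.rpow_mul (by positivity), Real.rpow_natCast]

/-! ### Uniform convergence of truncated integrals -/

/-- The error is at most the integral of `G` over the complement of `s r`, which does not depend on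
`y`. -/
theorem tendstoUniformly_setIntegral {X Y : Type*} [MeasurableSpace X] {μ : Measure X}
    {F : Y → X → ℂ} {G : X → ℝ} {s : ℝ → Set X} (hF : ∀ y, Integrable (F y) μ)
    (hG : Integrable G μ) (hFG : ∀ y x, ‖F y x‖ ≤ G x) (hs : ∀ r, MeasurableSet (s r))
    (hmono : Monotone s) (hU : ⋃ r, s r = univ) :
    TendstoUniformly (fun r y => ∫ x in s r, F y x ∂μ) (fun y => ∫ x, F y x ∂μ) atTop := by
  have h := tendsto_setIntegral_of_monotone (μ := μ) (f := G) hs hmono hG.integrableOn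
  rw [hU, setIntegral_univ] at h
  rw [Metric.tendstoUniformly_iff]
  intro ε hε
  filter_upwards [h.eventually (lt_mem_nhds (sub_lt_self _ hε))] with r hr y
  have h1 := integral_add_compl (hs r) (hF y)
  have h2 := integral_add_compl (hs r) hG
  rw [dist_eq_norm, ← h1, add_sub_cancel_left]
  calc ‖∫ x in (s r)ᶜ, F y x ∂μ‖ ≤ ∫ x in (s r)ᶜ, G x ∂μ :=
        norm_integral_le_of_norm_le hG.integrableOn (Eventually.of_forall fun x => hFG y x)
    _ < ε := by linarith

/-! ### The solution in Fourier variables -/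

/-- The transform `E_ρ(-A(ξ) t^ρ) h(ξ)` of the solution with initial transform `h`. -/
noncomputable def evolved (A : MvPolynomial (Fin N) ℝ) (ρ : ℝ) (h : 𝔼 → ℂ) (t : ℝ) (ξ : 𝔼) : ℂ :=
  (mittagLeffler ρ (-symbol A ξ * t ^ ρ) : ℂ) * h ξ

theorem solutionIntegrand_eq (A : MvPolynomial (Fin N) ℝ) (ρ : ℝ) (φ : 𝔼 → ℂ) (x : 𝔼) (t : ℝ)
    (ξ : 𝔼) : solutionIntegrand A ρ φ x t ξ = evolved A ρ (fourierL2 φ) t ξ *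
      Complex.exp (Complex.I * ((inner ℝ x ξ : ℝ) : ℂ)) := rfl

theorem evolved_zero (A : MvPolynomial (Fin N) ℝ) {ρ : ℝ} (hρ : 0 < ρ) (h : 𝔼 → ℂ) :
    evolved A ρ h 0 = h := by
  funext ξ
  rw [evolved, Real.zero_rpow hρ.ne', mul_zero, mittagLeffler_zero, Complex.ofReal_one, one_mul]

theorem continuous_mittagLeffler_symbol (A : MvPolynomial (Fin N) ℝ) {ρ : ℝ} (hρ : 0 < ρ) :
    Continuous fun p : ℝ × 𝔼 => mittagLeffler ρ (-symbol A p.2 * p.1 ^ ρ) :=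
  (continuous_mittagLeffler hρ).comp (((continuous_symbol A).comp continuous_snd).neg.mul
    ((Real.continuous_rpow_const hρ.le).comp continuous_fst))

variable {ρ : ℝ} {h : EuclideanSpace ℝ (Fin N) → ℂ}

theorem aestronglyMeasurable_evolved (A : MvPolynomial (Fin N) ℝ) (hρ : 0 < ρ)
    (hm : AEStronglyMeasurable h) (t : ℝ) : AEStronglyMeasurable (evolved A ρ h t) :=
  (Complex.continuous_ofReal.comp ((continuous_mittagLeffler_symbol A hρ).comp
    (Continuous.prodMk_right t))).aestronglyMeasurable.mul hm

theorem norm_evolved_le (hA : IsHomogeneousElliptic A l) (hl : 0 < l) (hρ : ρ ∈ Ioo (0 : ℝ) 1)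
    {t : ℝ} (ht : 0 ≤ t) (ξ : 𝔼) : ‖evolved A ρ h t ξ‖ ≤ ‖h ξ‖ := by
  have := mittagLeffler_mem_Icc hρ (hA.symbol_nonneg hl ξ) ht
  rw [evolved, norm_mul, Complex.norm_real, Real.norm_of_nonneg this.1]
  exact mul_le_of_le_one_left (norm_nonneg _) this.2

theorem symbol_mul_norm_evolved_le (hA : IsHomogeneousElliptic A l) (hl : 0 < l)
    (hρ : ρ ∈ Ioo (0 : ℝ) 1) {t : ℝ} (ht : 0 < t) (ξ : 𝔼) :
    symbol A ξ * ‖evolved A ρ h t ξ‖ ≤ Real.Gamma (ρ + 1) * (t ^ ρ)⁻¹ * ‖h ξ‖ := by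
  have h1 := mittagLeffler_mem_Icc hρ (hA.symbol_nonneg hl ξ) ht.le
  rw [evolved, norm_mul, Complex.norm_real, Real.norm_of_nonneg h1.1, ← mul_assoc]
  exact mul_le_mul_of_nonneg_right (mul_mittagLeffler_le hρ (hA.symbol_nonneg hl ξ) ht)
    (norm_nonneg _)

/-- Bounds (a) and (b) combined: low powers of `|ξ|` are absorbed by `1 + |ξ|^{2l}`, and ellipticity
replaces `|ξ|^{2l}` by the symbol. The constant depends on `t` and blows up as `t → 0`. -/
theorem exists_norm_pow_mul_evolved_le (hA : IsHomogeneousElliptic A l) (hl : 0 < l)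
    (hρ : ρ ∈ Ioo (0 : ℝ) 1) (h : 𝔼 → ℂ) {t : ℝ} (ht : 0 < t) :
    ∃ C, ∀ k ≤ 2 * l, ∀ ξ : 𝔼, ‖ξ‖ ^ k * ‖evolved A ρ h t ξ‖ ≤ C * ‖h ξ‖ := by
  obtain ⟨C, hC0, hC⟩ := hA.norm_pow_le hl
  refine ⟨1 + C * (Real.Gamma (ρ + 1) * (t ^ ρ)⁻¹), fun k hk ξ => ?_⟩
  have h1 : ‖ξ‖ ^ k ≤ 1 + ‖ξ‖ ^ (2 * l) := by
    rcases le_total ‖ξ‖ 1 with h | h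
    · exact (pow_le_one₀ (norm_nonneg _) h).trans (by linarith [pow_nonneg (norm_nonneg ξ) (2 * l)])
    · exact (pow_le_pow_right₀ h hk).trans (by linarith)
  calc ‖ξ‖ ^ k * ‖evolved A ρ h t ξ‖
      ≤ (1 + C * symbol A ξ) * ‖evolved A ρ h t ξ‖ := by
        gcongr
        exact h1.trans (by linarith [hC ξ])
    _ = ‖evolved A ρ h t ξ‖ + C * (symbol A ξ * ‖evolved A ρ h t ξ‖) := by ring
    _ ≤ ‖h ξ‖ + C * (Real.Gamma (ρ + 1) * (t ^ ρ)⁻¹ * ‖h ξ‖) :=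
        add_le_add (norm_evolved_le hA hl hρ ht.le ξ)
          (mul_le_mul_of_nonneg_left (symbol_mul_norm_evolved_le hA hl hρ ht ξ) hC0)
    _ = _ := by ring

theorem hasMoments_evolved (hA : IsHomogeneousElliptic A l) (hl : 0 < l) (hρ : ρ ∈ Ioo (0 : ℝ) 1)
    (h1 : Integrable h) {t : ℝ} (ht : 0 < t) : HasMoments (2 * l) (evolved A ρ h t) := by
  obtain ⟨C, hC⟩ := exists_norm_pow_mul_evolved_le hA hl hρ h ht
  have hm := aestronglyMeasurable_evolved A hρ.1 h1.1 t
  refine ⟨hm, fun k hk => (h1.norm.const_mul C).mono'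
    (AEStronglyMeasurable.mul (by fun_prop) hm.norm) (Eventually.of_forall fun ξ => ?_)⟩
  rw [Real.norm_of_nonneg (by positivity)]
  exact hC k hk ξ

theorem integrable_evolved (hA : IsHomogeneousElliptic A l) (hl : 0 < l) (hρ : ρ ∈ Ioo (0 : ℝ) 1)
    (h1 : Integrable h) {t : ℝ} (ht : 0 ≤ t) : Integrable (evolved A ρ h t) :=
  h1.norm.mono' (aestronglyMeasurable_evolved A hρ.1 h1.1 t)
    (Eventually.of_forall (norm_evolved_le hA hl hρ ht))

theorem memLp_monomial_mul_evolved (hA : IsHomogeneousElliptic A l) (hl : 0 < l)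
    (hρ : ρ ∈ Ioo (0 : ℝ) 1) (h2 : MemLp h 2) {t : ℝ} (ht : 0 < t) {α : Fin N →₀ ℕ}
    (hα : α.degree ≤ 2 * l) :
    MemLp (fun ξ => (∏ j, (ξ j : ℂ) ^ α j) * evolved A ρ h t ξ) 2 := by
  obtain ⟨C, hC⟩ := exists_norm_pow_mul_evolved_le hA hl hρ h ht
  refine h2.of_le_mul (c := C) (AEStronglyMeasurable.mul (by fun_prop)
    (aestronglyMeasurable_evolved A hρ.1 h2.1 t)) (Eventually.of_forall fun ξ => ?_)
  rw [norm_mul, norm_prod]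
  simp_rw [norm_pow, Complex.norm_real, Real.norm_eq_abs]
  exact (mul_le_mul_of_nonneg_right (prod_abs_pow_le α ξ) (norm_nonneg _)).trans (hC _ hα ξ)

theorem continuous_evolved_apply (A : MvPolynomial (Fin N) ℝ) (hρ : 0 < ρ)
    (h : EuclideanSpace ℝ (Fin N) → ℂ) (ξ : 𝔼) : Continuous fun t => evolved A ρ h t ξ :=
  (Complex.continuous_ofReal.comp ((continuous_mittagLeffler hρ).comp
    (continuous_const.mul (Real.continuous_rpow_const hρ.le)))).mul continuous_const

theorem continuous_exp_inner (ξ : 𝔼) : Continuous fun p : 𝔼 × ℝ =>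
    Complex.exp (Complex.I * ((inner ℝ p.1 ξ : ℝ) : ℂ)) := by fun_prop

theorem continuousOn_expIntegral_evolved (hA : IsHomogeneousElliptic A l) (hl : 0 < l)
    (hρ : ρ ∈ Ioo (0 : ℝ) 1) (h1 : Integrable h) :
    ContinuousOn (fun p : 𝔼 × ℝ => expIntegral (evolved A ρ h p.2) p.1) (univ ×ˢ Ici 0) := by
  refine continuousOn_of_dominated (bound := fun ξ => ‖h ξ‖)
    (fun p _ => (aestronglyMeasurable_evolved A hρ.1 h1.1 _).mul (by fun_prop))
    (fun p hp => Eventually.of_forall fun ξ => ?_) h1.norm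
    (Eventually.of_forall fun ξ => Continuous.continuousOn ?_)
  · rw [norm_mul, norm_exp_I_mul, mul_one]
    exact norm_evolved_le hA hl hρ hp.2 ξ
  · exact ((continuous_evolved_apply A hρ.1 h ξ).comp continuous_snd).mul (continuous_exp_inner ξ)

theorem continuousOn_expIntegral_symbol_mul_evolved (hA : IsHomogeneousElliptic A l) (hl : 0 < l)
    (hρ : ρ ∈ Ioo (0 : ℝ) 1) (h1 : Integrable h) :
    ContinuousOn (fun p : 𝔼 × ℝ => expIntegral (fun ξ => (symbol A ξ : ℂ) * evolved A ρ h p.2 ξ) p.1)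
      (univ ×ˢ Ioi 0) := by
  rintro ⟨x, t⟩ ⟨-, ht : 0 < t⟩
  refine ContinuousAt.continuousWithinAt ?_
  have hms := (continuous_symbol A).aestronglyMeasurable (μ := (volume : Measure 𝔼))
  refine continuousAt_of_dominated
    -- Bound (b) is singular at time `0`, so the domination is local, on times above `t / 2`.
    (bound := fun ξ => Real.Gamma (ρ + 1) * ((t / 2) ^ ρ)⁻¹ * ‖h ξ‖)
    (Eventually.of_forall fun p => ?_) ?_ (h1.norm.const_mul _)
    (Eventually.of_forall fun ξ => Continuous.continuousAt ?_)
  · exact ((Complex.continuous_ofReal.comp_aestronglyMeasurable hms).mul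
      (aestronglyMeasurable_evolved A hρ.1 h1.1 _)).mul (by fun_prop)
  · have hev : ∀ᶠ p : 𝔼 × ℝ in 𝓝 (x, t), t / 2 < p.2 :=
      continuousAt_snd.eventually (lt_mem_nhds (half_lt_self ht))
    filter_upwards [hev] with p hp
    refine Eventually.of_forall fun ξ => ?_
    have h0 := hA.symbol_nonneg hl ξ
    have hp2 : 0 < p.2 := (half_pos ht).trans hp
    have hΓ := Real.Gamma_pos_of_pos (add_pos hρ.1 one_pos)
    rw [norm_mul, norm_exp_I_mul, mul_one, norm_mul, Complex.norm_real, Real.norm_of_nonneg h0]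
    refine (symbol_mul_norm_evolved_le hA hl hρ hp2 ξ).trans ?_
    have := Real.rpow_le_rpow (half_pos ht).le hp.le hρ.1.le
    have := Real.rpow_pos_of_pos (half_pos ht) ρ
    gcongr
  · exact (continuous_const.mul ((continuous_evolved_apply A hρ.1 h ξ).comp continuous_snd)).mul
      (continuous_exp_inner ξ)

/-! ### The time derivative -/

/-- The function `E_{ρ,ρ}(z) = ∑ z^k / Γ(ρ k + ρ)`. -/
noncomputable def mittagLefflerDiag (ρ z : ℝ) : ℝ := ∑' k : ℕ, z ^ k / Real.Gamma (ρ * k + ρ)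

theorem continuous_mittagLefflerDiag (hρ : 0 < ρ) : Continuous (mittagLefflerDiag ρ) := by
  have h : GeomBound (fun _ => 1) 1 := ⟨zero_le_one, fun n => by simp⟩
  have h' := h.continuous hρ (β := ρ) hρ
  simp only [one_mul] at h'
  exact h'

theorem relaxation_eq_mittagLefflerDiag (ρ lam : ℝ) {t : ℝ} (ht : 0 < t) :
    relaxation ρ lam ρ t = t ^ (ρ - 1) * mittagLefflerDiag ρ (-lam * t ^ ρ) := by
  rw [relaxation_eq lam ρ ht, mittagLefflerDiag]
  congr 1
  exact tsum_congr fun n => by rw [mul_pow, mul_div_assoc]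

/-- The time derivative of `evolved`. -/
noncomputable def evolvedDeriv (A : MvPolynomial (Fin N) ℝ) (ρ : ℝ) (h : 𝔼 → ℂ) (t : ℝ) (ξ : 𝔼) :
    ℂ :=
  ((-symbol A ξ * (t ^ (ρ - 1) * mittagLefflerDiag ρ (-symbol A ξ * t ^ ρ)) : ℝ) : ℂ) * h ξ

theorem evolvedDeriv_eq (A : MvPolynomial (Fin N) ℝ) (ρ : ℝ) (h : 𝔼 → ℂ) {t : ℝ} (ht : 0 < t)
    (ξ : 𝔼) :
    evolvedDeriv A ρ h t ξ = ((-symbol A ξ * relaxation ρ (symbol A ξ) ρ t : ℝ) : ℂ) * h ξ := by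
  rw [evolvedDeriv, relaxation_eq_mittagLefflerDiag ρ _ ht]

theorem norm_evolvedDeriv (hA : IsHomogeneousElliptic A l) (hl : 0 < l) (hρ : ρ ∈ Ioo (0 : ℝ) 1)
    {t : ℝ} (ht : 0 < t) (ξ : 𝔼) :
    ‖evolvedDeriv A ρ h t ξ‖ = symbol A ξ * relaxation ρ (symbol A ξ) ρ t * ‖h ξ‖ := by
  have h0 := hA.symbol_nonneg hl ξ
  rw [evolvedDeriv_eq A ρ h ht, norm_mul, Complex.norm_real, neg_mul, norm_neg,
    Real.norm_of_nonneg (mul_nonneg h0 (relaxation_pos hρ h0 ht).le)]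

theorem aestronglyMeasurable_evolvedDeriv (A : MvPolynomial (Fin N) ℝ) (hρ : 0 < ρ)
    (hm : AEStronglyMeasurable h) (S : Set ℝ) :
    AEStronglyMeasurable (fun p : ℝ × 𝔼 => evolvedDeriv A ρ h p.1 p.2)
      ((volume.restrict S).prod volume) := by
  refine AEStronglyMeasurable.mul (Measurable.aestronglyMeasurable ?_) hm.comp_snd
  have h1 := (continuous_mittagLefflerDiag hρ).measurable
  have h2 := (continuous_symbol A).measurable
  exact Complex.measurable_ofReal.comp (by fun_prop)

theorem aestronglyMeasurable_evolvedDeriv_apply (A : MvPolynomial (Fin N) ℝ) (hρ : 0 < ρ)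
    (hm : AEStronglyMeasurable h) (t : ℝ) : AEStronglyMeasurable (evolvedDeriv A ρ h t) := by
  refine AEStronglyMeasurable.mul (Measurable.aestronglyMeasurable ?_) hm
  have h1 := (continuous_mittagLefflerDiag hρ).measurable
  have h2 := (continuous_symbol A).measurable
  exact Complex.measurable_ofReal.comp (by fun_prop)

theorem hasDerivAt_expIntegral_evolved (hA : IsHomogeneousElliptic A l) (hl : 0 < l)
    (hρ : ρ ∈ Ioo (0 : ℝ) 1) (h1 : Integrable h) (x : 𝔼) {t : ℝ} (ht : 0 < t) :
    HasDerivAt (fun s => expIntegral (evolved A ρ h s) x)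
      (expIntegral (evolvedDeriv A ρ h t) x) t := by
  refine (hasDerivAt_integral_of_dominated_loc_of_deriv_le (𝕜 := ℝ) (μ := volume) (x₀ := t)
    (F := fun s ξ => evolved A ρ h s ξ * Complex.exp (Complex.I * ((inner ℝ x ξ : ℝ) : ℂ)))
    (F' := fun s ξ => evolvedDeriv A ρ h s ξ *
      Complex.exp (Complex.I * ((inner ℝ x ξ : ℝ) : ℂ)))
    -- Away from time `0` the bound `s λ r(s) ≤ 1` suffices, so no weight on `h` is needed.
    (bound := fun ξ => (t / 2)⁻¹ * ‖h ξ‖) (Ioi_mem_nhds (half_lt_self ht))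
    (Eventually.of_forall fun s => (aestronglyMeasurable_evolved A hρ.1 h1.1 s).mul (by fun_prop))
    (integrable_mul_exp (integrable_evolved hA hl hρ h1 ht.le) x)
    ((aestronglyMeasurable_evolvedDeriv_apply A hρ.1 h1.1 t).mul (by fun_prop))
    (Eventually.of_forall fun ξ s hs => ?_) (h1.norm.const_mul _)
    (Eventually.of_forall fun ξ s hs => ?_)).2
  · have hs0 : 0 < s := (half_pos ht).trans hs
    have hb := (mul_mul_relaxation_le_min hρ (hA.symbol_nonneg hl ξ) hs0).trans (min_le_left _ _)
    rw [norm_mul, norm_exp_I_mul, mul_one, norm_evolvedDeriv hA hl hρ hs0]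
    gcongr
    calc symbol A ξ * relaxation ρ (symbol A ξ) ρ s ≤ s⁻¹ := by
          rw [← one_div, le_div_iff₀ hs0]
          linarith
      _ ≤ (t / 2)⁻¹ := inv_anti₀ (half_pos ht) (le_of_lt hs)
  · have hs0 : 0 < s := (half_pos ht).trans hs
    simp only [evolvedDeriv_eq A ρ h hs0]
    exact ((hasDerivAt_mittagLeffler hρ (hA.symbol_nonneg hl ξ) hs0).ofReal_comp.mul_const
      (h ξ)).mul_const _

theorem integrable_caputo_kernel (hA : IsHomogeneousElliptic A l) (hl : 0 < l)
    (hρ : ρ ∈ Ioo (0 : ℝ) 1) (h1 : Integrable h) {ε : ℝ} (hε : ε ∈ Ioc (0 : ℝ) 1)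
    (hsym : Integrable fun ξ : 𝔼 => symbol A ξ ^ ε * ‖h ξ‖) (x : 𝔼) {t : ℝ} (ht : 0 < t) :
    Integrable (fun p : ℝ × 𝔼 => (fracKernel (1 - ρ) (t - p.1) : ℂ) *
      (evolvedDeriv A ρ h p.1 p.2 * Complex.exp (Complex.I * ((inner ℝ x p.2 : ℝ) : ℂ))))
      ((volume.restrict (Ioo 0 t)).prod volume) := by
  have hρε : 0 < ρ * ε := mul_pos hρ.1 hε.1
  -- By (c) the integrand is dominated by a product of a function of `s` and a function of `ξ`. The
  -- time factor is the Beta integrand of orders `1 - ρ` and `ρε`, which is where `ε > 0` is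
  -- indispensable; `Γ(ρε)` cancels the normalisation.
  have hb := (integrableOn_fracKernel (sub_pos.2 hρ.2) hρε ht).mul_prod
    (hsym.const_mul ((Real.Gamma (ρ + 1))⁻¹ ^ ε * Real.Gamma (ρ * ε)))
  refine hb.mono' ?_ ?_
  · refine AEStronglyMeasurable.mul (Measurable.aestronglyMeasurable ?_)
      ((aestronglyMeasurable_evolvedDeriv A hρ.1 h1.1 _).mul (by fun_prop))
    have := measurable_fracKernel (1 - ρ)
    exact Complex.measurable_ofReal.comp (by fun_prop)
  · have e : (volume.restrict (Ioo 0 t)).prod (volume : Measure 𝔼)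
        = (volume.prod volume).restrict (Ioo 0 t ×ˢ univ) := by
      rw [← Measure.prod_restrict, Measure.restrict_univ]
    rw [e]
    refine ae_restrict_of_forall_mem (measurableSet_Ioo.prod MeasurableSet.univ) ?_
    rintro ⟨s, ξ⟩ ⟨hs, -⟩
    have hs0 : 0 < s := hs.1
    have hk := fracKernel_pos (sub_pos.2 hρ.2) (sub_pos.2 hs.2)
    have hb := mul_relaxation_le_rpow hρ (hA.symbol_nonneg hl ξ) hs0 hε
    have hΓ := Real.Gamma_pos_of_pos hρε
    simp only
    rw [norm_mul, Complex.norm_real, Real.norm_of_nonneg hk.le, norm_mul, norm_exp_I_mul, mul_one,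
      norm_evolvedDeriv hA hl hρ hs0]
    calc fracKernel (1 - ρ) (t - s) * (symbol A ξ * relaxation ρ (symbol A ξ) ρ s * ‖h ξ‖)
        ≤ fracKernel (1 - ρ) (t - s) *
          ((Real.Gamma (ρ + 1))⁻¹ ^ ε * symbol A ξ ^ ε * s ^ (ρ * ε - 1) * ‖h ξ‖) := by gcongr
      _ = _ := by
        rw [fracKernel.eq_def (ρ * ε)]
        field_simp

theorem inv_rpow_smul_eq (hρ : ρ ∈ Ioo (0 : ℝ) 1) {s t : ℝ} (hs : s < t) (z : ℂ) :
    ((t - s) ^ ρ)⁻¹ • z = (Real.Gamma (1 - ρ) : ℂ) * ((fracKernel (1 - ρ) (t - s) : ℂ) * z) := by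
  have hΓ : (Real.Gamma (1 - ρ) : ℂ) ≠ 0 := by
    exact_mod_cast (Real.Gamma_pos_of_pos (sub_pos.2 hρ.2)).ne'
  rw [fracKernel, show (1 - ρ - 1 : ℝ) = -ρ by ring, Real.rpow_neg (sub_pos.2 hs).le,
    Complex.real_smul]
  push_cast
  field_simp

theorem caputoExists_expIntegral_evolved (hA : IsHomogeneousElliptic A l) (hl : 0 < l)
    (hρ : ρ ∈ Ioo (0 : ℝ) 1) (h1 : Integrable h) {ε : ℝ} (hε : ε ∈ Ioc (0 : ℝ) 1)
    (hsym : Integrable fun ξ : 𝔼 => symbol A ξ ^ ε * ‖h ξ‖) (x : 𝔼) {t : ℝ} (ht : 0 < t) :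
    CaputoExists ρ (fun s => expIntegral (evolved A ρ h s) x) t := by
  have hd := fun {s : ℝ} (hs : 0 < s) => hasDerivAt_expIntegral_evolved hA hl hρ h1 x hs
  refine ⟨fun s hs => (hd hs.1).differentiableAt, ?_⟩
  have hi := (integrable_caputo_kernel hA hl hρ h1 hε hsym x ht).integral_prod_left.const_mul
    (Real.Gamma (1 - ρ) : ℂ)
  refine IntegrableOn.congr_fun (f := fun s => (Real.Gamma (1 - ρ) : ℂ) * _) hi
    (fun s hs => ?_) measurableSet_Ioo
  simp only
  rw [inv_rpow_smul_eq hρ hs.2, (hd hs.1).deriv, integral_const_mul]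
  rfl

theorem caputoDeriv_expIntegral_evolved (hA : IsHomogeneousElliptic A l) (hl : 0 < l)
    (hρ : ρ ∈ Ioo (0 : ℝ) 1) (h1 : Integrable h) {ε : ℝ} (hε : ε ∈ Ioc (0 : ℝ) 1)
    (hsym : Integrable fun ξ : 𝔼 => symbol A ξ ^ ε * ‖h ξ‖) (x : 𝔼) {t : ℝ} (ht : 0 < t) :
    caputoDeriv ρ (fun s => expIntegral (evolved A ρ h s) x) t
      = -expIntegral (fun ξ => (symbol A ξ : ℂ) * evolved A ρ h t ξ) x := by
  have hd := fun {s : ℝ} (hs : 0 < s) => hasDerivAt_expIntegral_evolved hA hl hρ h1 x hs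
  have hΓ : (Real.Gamma (1 - ρ) : ℂ) ≠ 0 := by
    exact_mod_cast (Real.Gamma_pos_of_pos (sub_pos.2 hρ.2)).ne'
  have e1 : ∫ s in (0 : ℝ)..t, ((t - s) ^ (ρ - 1 + 1))⁻¹ •
      deriv (fun s => expIntegral (evolved A ρ h s) x) s
      = (Real.Gamma (1 - ρ) : ℂ) * ∫ s in Ioo 0 t, ∫ ξ, (fracKernel (1 - ρ) (t - s) : ℂ) *
        (evolvedDeriv A ρ h s ξ * Complex.exp (Complex.I * ((inner ℝ x ξ : ℝ) : ℂ))) := by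
    rw [intervalIntegral.integral_of_le ht.le, integral_Ioc_eq_integral_Ioo, ← integral_const_mul]
    refine setIntegral_congr_fun measurableSet_Ioo fun s hs => ?_
    simp only [sub_add_cancel]
    rw [inv_rpow_smul_eq hρ hs.2, (hd hs.1).deriv, integral_const_mul]
    rfl
  have e2 : ∀ ξ : 𝔼, ∫ s in Ioo 0 t, (fracKernel (1 - ρ) (t - s) : ℂ) *
      (evolvedDeriv A ρ h s ξ * Complex.exp (Complex.I * ((inner ℝ x ξ : ℝ) : ℂ)))
      = -((symbol A ξ : ℂ) * evolved A ρ h t ξ *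
        Complex.exp (Complex.I * ((inner ℝ x ξ : ℝ) : ℂ))) := fun ξ => by
    have h3 : ∫ s in Ioo 0 t, (fracKernel (1 - ρ) (t - s) : ℂ) *
        (evolvedDeriv A ρ h s ξ * Complex.exp (Complex.I * ((inner ℝ x ξ : ℝ) : ℂ)))
        = ∫ s in Ioo 0 t, ((fracKernel (1 - ρ) (t - s) *
          (-symbol A ξ * relaxation ρ (symbol A ξ) ρ s) : ℝ) : ℂ) *
          (h ξ * Complex.exp (Complex.I * ((inner ℝ x ξ : ℝ) : ℂ))) := by
      refine setIntegral_congr_fun measurableSet_Ioo fun s hs => ?_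
      rw [evolvedDeriv_eq A ρ h hs.1]
      push_cast
      ring
    rw [h3, integral_mul_const, integral_complex_ofReal,
      setIntegral_caputo_mittagLeffler hρ (hA.symbol_nonneg hl ξ) ht, evolved]
    push_cast
    ring
  have hswap := integral_integral_swap (f := fun (s : ℝ) (ξ : 𝔼) =>
    (fracKernel (1 - ρ) (t - s) : ℂ) *
      (evolvedDeriv A ρ h s ξ * Complex.exp (Complex.I * ((inner ℝ x ξ : ℝ) : ℂ))))
    (integrable_caputo_kernel hA hl hρ h1 hε hsym x ht)
  -- After Fubini the inner integral is the scalar Caputo derivative, computed in `e2` at each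
  -- frequency.
  rw [caputoDeriv, rlIntegral, e1, hswap]
  simp_rw [e2]
  rw [integral_neg, neg_sub, Complex.real_smul, Complex.ofReal_inv, inv_mul_cancel_left₀ hΓ]
  rfl

end Euclidean

end Subdiffusion

/-! ### Verification of the solution and of its properties -/

theorem theorem1p1 {N : ℕ} (hN : 0 < N) {l : ℕ} (hl : 0 < l)
    (A : MvPolynomial (Fin N) ℝ) (hA : Subdiffusion.IsHomogeneousElliptic A l)
    (ρ : ℝ) (hρ : ρ ∈ Ioo (0 : ℝ) 1) (T : ℝ) (hT : 0 < T)
    (τ : ℝ) (hτ : (N : ℝ) / 2 < τ)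
    (φ : EuclideanSpace ℝ (Fin N) → ℂ) (hφ : Subdiffusion.MemSobolevClass τ φ) :
    ∃ (φ₀ : EuclideanSpace ℝ (Fin N) → ℂ) (u : EuclideanSpace ℝ (Fin N) → ℝ → ℂ),
      -- `φ₀` is the continuous representative of `φ`
      Continuous φ₀ ∧ φ₀ =ᵐ[volume] φ ∧
      Subdiffusion.IsClassicalSolution A l ρ T φ₀ u ∧
      -- the integral formula
      (∀ x, ∀ t ∈ Icc 0 T,
        Integrable (Subdiffusion.solutionIntegrand A ρ φ x t) volume ∧
        u x t = ∫ ξ, Subdiffusion.solutionIntegrand A ρ φ x t ξ) ∧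
      -- uniform convergence of the integral in `x`, for truncation to `A(ξ) < μ` and to `|ξ| < μ`
      (∀ t ∈ Ioc 0 T,
        TendstoUniformly
          (fun (μ : ℝ) x => ∫ ξ in {ξ | Subdiffusion.symbol A ξ < μ},
            Subdiffusion.solutionIntegrand A ρ φ x t ξ)
          (fun x => u x t) atTop ∧
        TendstoUniformly
          (fun (μ : ℝ) x => ∫ ξ in Metric.ball 0 μ,
            Subdiffusion.solutionIntegrand A ρ φ x t ξ)
          (fun x => u x t) atTop) ∧
      Subdiffusion.UniquenessConditions l T φ₀ u := by
  set h := Subdiffusion.fourierL2 φ with hh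
  have h1 : Integrable h := hφ.integrable_fourierL2 hτ
  have h2 : MemLp h 2 := Subdiffusion.memLp_fourierL2 hφ.1
  obtain ⟨ε, hε, hsym⟩ := hφ.exists_integrable_symbol_rpow hA hl hτ
  have hmom := fun {t : ℝ} (ht : t ∈ Ioc 0 T) =>
    Subdiffusion.hasMoments_evolved hA hl hρ h1 ht.1
  have hdiff : ∀ t ∈ Ioc 0 T, ∀ x,
      Subdiffusion.diffOp A (fun y => Subdiffusion.expIntegral (Subdiffusion.evolved A ρ h t) y) x
        = Subdiffusion.expIntegral (fun ξ => (Subdiffusion.symbol A ξ : ℂ) *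
          Subdiffusion.evolved A ρ h t ξ) x := fun t ht x =>
    Subdiffusion.diffOp_expIntegral hA.homogeneous (hmom ht) x
  have hcap := fun (x : EuclideanSpace ℝ (Fin N)) {t : ℝ} (ht : t ∈ Ioc 0 T) =>
    Subdiffusion.caputoDeriv_expIntegral_evolved hA hl hρ h1 hε hsym x ht.1
  have hcont : ContinuousOn (fun p : EuclideanSpace ℝ (Fin N) × ℝ =>
      Subdiffusion.expIntegral (fun ξ => (Subdiffusion.symbol A ξ : ℂ) *
        Subdiffusion.evolved A ρ h p.2 ξ) p.1) (univ ×ˢ Ioc 0 T) :=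
    (Subdiffusion.continuousOn_expIntegral_symbol_mul_evolved hA hl hρ h1).mono
      (prod_mono subset_rfl fun t ht => ht.1)
  have hmulti : ∀ t ∈ Ioc 0 T, ∀ α : Fin N →₀ ℕ, α.degree ≤ 2 * l →
      Subdiffusion.multiD α (Subdiffusion.expIntegral (Subdiffusion.evolved A ρ h t))
        = Subdiffusion.expIntegral (fun ξ => (∏ j, (ξ j : ℂ) ^ α j) *
          Subdiffusion.evolved A ρ h t ξ) ∧
      Subdiffusion.HasMoments 0 fun ξ => (∏ j, (ξ j : ℂ) ^ α j) *
          Subdiffusion.evolved A ρ h t ξ := fun t ht α hα =>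
    Subdiffusion.multiD_expIntegral α ((hmom ht).mono (by omega))
  have hdecay : ∀ t ∈ Ioc 0 T, ∀ α : Fin N →₀ ℕ, α.degree ≤ 2 * l →
      Tendsto (Subdiffusion.multiD α (Subdiffusion.expIntegral (Subdiffusion.evolved A ρ h t)))
        (cocompact (EuclideanSpace ℝ (Fin N))) (𝓝 0) := fun t ht α hα => by
    rw [(hmulti t ht α hα).1]
    exact Subdiffusion.tendsto_expIntegral_cocompact _
  have hint := fun {t : ℝ} (ht : 0 ≤ t) => Subdiffusion.integrable_evolved hA hl hρ h1 ht
  have hunif : ∀ t ∈ Ioc 0 T, ∀ s : ℝ → Set (EuclideanSpace ℝ (Fin N)),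
      (∀ r, MeasurableSet (s r)) → Monotone s → ⋃ r, s r = univ →
      TendstoUniformly (fun (μ : ℝ) x => ∫ ξ in s μ, Subdiffusion.solutionIntegrand A ρ φ x t ξ)
        (fun x => Subdiffusion.expIntegral (Subdiffusion.evolved A ρ h t) x) atTop :=
    fun t ht s hs hmono hU => by
      refine Subdiffusion.tendstoUniformly_setIntegral
        (F := fun x ξ => Subdiffusion.solutionIntegrand A ρ φ x t ξ)
        (fun x => Subdiffusion.integrable_mul_exp (hint ht.1.le) x) h1.norm (fun x ξ => ?_)
        hs hmono hU
      rw [Subdiffusion.solutionIntegrand_eq, norm_mul, Subdiffusion.norm_exp_I_mul, mul_one]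
      exact Subdiffusion.norm_evolved_le hA hl hρ ht.1.le ξ
  -- The representative of `φ` is the inverse Fourier integral of `φ̂`; it agrees with `u` at `t =
  -- 0` because `E_ρ(0) = 1`.
  refine ⟨Subdiffusion.expIntegral h,
    fun x t => Subdiffusion.expIntegral (Subdiffusion.evolved A ρ h t) x,
    Subdiffusion.continuous_expIntegral h1, Subdiffusion.expIntegral_fourierL2 hφ.1 h1,
    { continuousOn := ?_
      contDiff := fun t ht => Subdiffusion.contDiff_expIntegral (hmom ht)
      caputoExists := fun x t ht =>
        Subdiffusion.caputoExists_expIntegral_evolved hA hl hρ h1 hε hsym x ht.1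
      continuousOn_caputo := hcont.neg.congr fun p hp => hcap p.1 hp.2
      continuousOn_diffOp := hcont.congr fun p hp => hdiff p.2 hp.2 p.1
      equation := fun x t ht => by rw [hcap x ht, hdiff t ht x, neg_add_cancel]
      decay := fun α hα t ht => hdecay t ht α (by omega)
      initial := fun x => by simp only [Subdiffusion.evolved_zero A hρ.1] },
    fun x t ht => ⟨Subdiffusion.integrable_mul_exp (hint ht.1) x, rfl⟩,
    fun t ht => ⟨hunif t ht _ (fun μ => ?_) ?_ ?_, hunif t ht _ (fun μ => measurableSet_ball) ?_ ?_⟩,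
    { continuous_initial := Subdiffusion.continuous_expIntegral h1
      decay := fun t ht α _ hα => hdecay t ht α hα.le
      memLp := fun t ht α hα => ?_
      integrable_fourier := fun t ht => ?_ }⟩
  · exact (Subdiffusion.continuousOn_expIntegral_evolved hA hl hρ h1).mono
      (prod_mono subset_rfl fun t ht => ht.1)
  · exact measurableSet_lt (Subdiffusion.continuous_symbol A).measurable measurable_const
  · exact fun a b hab ξ hξ => lt_of_lt_of_le hξ hab
  · exact eq_univ_of_forall fun ξ => mem_iUnion.2
      ⟨Subdiffusion.symbol A ξ + 1, lt_add_one (Subdiffusion.symbol A ξ)⟩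
  · exact fun a b hab => Metric.ball_subset_ball hab
  · exact eq_univ_of_forall fun ξ => mem_iUnion.2 ⟨‖ξ‖ + 1, by simp⟩
  · have hm := hmulti t ht α hα
    change MemLp (Subdiffusion.multiD α
      (Subdiffusion.expIntegral (Subdiffusion.evolved A ρ h t))) 2 volume
    rw [hm.1]
    exact Subdiffusion.memLp_expIntegral hm.2.integrable
      (Subdiffusion.memLp_monomial_mul_evolved hA hl hρ h2 ht.1 hα)
  · have h2t : MemLp (Subdiffusion.evolved A ρ h t) 2 :=
      h2.of_le (Subdiffusion.aestronglyMeasurable_evolved A hρ.1 h1.1 t)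
        (Eventually.of_forall (Subdiffusion.norm_evolved_le hA hl hρ ht.1.le))
    exact (hint ht.1.le).congr (Subdiffusion.fourierL2_expIntegral (hint ht.1.le) h2t).symm
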